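/- The minimum $k$-vertex-edge domination problem can be solved in linear time for trees. That is: for a graph $G=(V,E)$ and an integer $k$, call $D\subseteq V$ a $k$-vertex-edge dominating set of $G$ if $|(N_G[u]\cup N_G[v])\cap D|\ge k$ for every edge $uv\in E$, where $N_G[x]$ is the closed neighbourhood of $x$. There are a single algorithm (a program of a random access machine with unit costs, whose only arithmetic operations are addition and subtraction) and a single constant $c$ such that, for every $n\ge 1$, every tree $T$ with vertex set $\{0,\dots,n-1\}$, given by a list of its edges in any order, and every integer $k$, the algorithm halts on input $(T,k)$ after at most $c\,n$ steps and outputs a $k$-vertex-edge dominating set of $T$ of minimum cardinality, or reports that $T$ has no $k$-vertex-edge dominating set if that is the case. -/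

import Mathlib

/-! ### Vertex-edge domination -/

namespace VEDom

/-- The closed neighbourhood `N[v] = N(v) ∪ {v}`. -/
def closedNbhd {V : Type*} (G : SimpleGraph V) (v : V) : Set V :=
  insert v (G.neighborSet v)

/-- `D` is a `k`-vertex-edge dominating set of `G`: every edge `uv` satisfies
`|(N[u] ∪ N[v]) ∩ D| ≥ k`. -/
def IsKVEDominating {V : Type*} (G : SimpleGraph V) (k : ℤ) (D : Finset V) : Prop :=
  ∀ u v : V, G.Adj u v →
    k ≤ (((closedNbhd G u ∪ closedNbhd G v) ∩ (D : Set V)).ncard : ℤ)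

/-- `D` is a `k`-vertex-edge dominating set of minimum cardinality. -/
def IsMinKVEDominating {V : Type*} (G : SimpleGraph V) (k : ℤ) (D : Finset V) : Prop :=
  IsKVEDominating G k D ∧ ∀ D' : Finset V, IsKVEDominating G k D' → D.card ≤ D'.card

end VEDom

/-! ### A random access machine with unit costs

Programs are structured (sequencing, branching, `while`) over an unbounded supply of integer
registers, an integer memory with indirect addressing, a read-only input tape and a write-only
output tape. The only arithmetic operations are addition and subtraction. -/

namespace RAM

/-- Comparisons of the contents of two registers. -/
inductive Test where
  | lt (a b : ℕ)
  | le (a b : ℕ)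
  | eq (a b : ℕ)

/-- Programs. Registers are named by natural numbers. -/
inductive Prog where
  /-- do nothing -/
  | skip
  /-- `r := z` -/
  | const (r : ℕ) (z : ℤ)
  /-- `r := a` -/
  | copy (r a : ℕ)
  /-- `r := a + b` -/
  | add (r a b : ℕ)
  /-- `r := a - b` -/
  | sub (r a b : ℕ)
  /-- `r := mem[a]` -/
  | load (r a : ℕ)
  /-- `mem[a] := b` -/
  | store (a b : ℕ)
  /-- move the next number of the input tape to `r` -/
  | read (r : ℕ)
  /-- append `a` to the output tape -/
  | write (a : ℕ)
  /-- run `p`, then `q` -/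
  | seq (p q : Prog)
  /-- `if b then p else q` -/
  | ite (b : Test) (p q : Prog)
  /-- `while b do p` -/
  | while (b : Test) (p : Prog)

/-- Machine states: registers, memory, the unread part of the input, the output so far. -/
structure State where
  reg : ℕ → ℤ
  mem : ℕ → ℤ
  inp : List ℤ
  out : List ℤ

/-- The initial state: registers and memory are zero, nothing has been written. -/
def State.init (input : List ℤ) : State where
  reg := fun _ => 0
  mem := fun _ => 0
  inp := input
  out := []

/-- The state after `r := z`. -/
def State.setReg (σ : State) (r : ℕ) (z : ℤ) : State :=
  { σ with reg := Function.update σ.reg r z }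

/-- The state after `mem[i] := z`. -/
def State.setMem (σ : State) (i : ℕ) (z : ℤ) : State :=
  { σ with mem := Function.update σ.mem i z }

/-- The truth of a test in a state. -/
def Test.Holds (σ : State) : Test → Prop
  | .lt a b => σ.reg a < σ.reg b
  | .le a b => σ.reg a ≤ σ.reg b
  | .eq a b => σ.reg a = σ.reg b

/-- `Exec p σ t τ`: started in state `σ`, the program `p` halts in state `τ` after exactly `t`
steps. Every elementary instruction and every evaluation of a test is one step. An access to a
negative address, or a `read` from an exhausted tape, blocks the machine for ever. -/
inductive Exec : Prog → State → ℕ → State → Prop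
  | skip (σ : State) : Exec .skip σ 1 σ
  | const (σ : State) (r : ℕ) (z : ℤ) : Exec (.const r z) σ 1 (σ.setReg r z)
  | copy (σ : State) (r a : ℕ) : Exec (.copy r a) σ 1 (σ.setReg r (σ.reg a))
  | add (σ : State) (r a b : ℕ) : Exec (.add r a b) σ 1 (σ.setReg r (σ.reg a + σ.reg b))
  | sub (σ : State) (r a b : ℕ) : Exec (.sub r a b) σ 1 (σ.setReg r (σ.reg a - σ.reg b))
  | load (σ : State) (r a i : ℕ) (h : σ.reg a = (i : ℤ)) :
      Exec (.load r a) σ 1 (σ.setReg r (σ.mem i))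
  | store (σ : State) (a b i : ℕ) (h : σ.reg a = (i : ℤ)) :
      Exec (.store a b) σ 1 (σ.setMem i (σ.reg b))
  | read (σ : State) (r : ℕ) (z : ℤ) (rest : List ℤ) (h : σ.inp = z :: rest) :
      Exec (.read r) σ 1 { σ.setReg r z with inp := rest }
  | write (σ : State) (a : ℕ) : Exec (.write a) σ 1 { σ with out := σ.out ++ [σ.reg a] }
  | seq (p q : Prog) (σ τ ρ : State) (s t : ℕ) (hp : Exec p σ s τ) (hq : Exec q τ t ρ) :
      Exec (.seq p q) σ (s + t) ρ
  | iteTrue (b : Test) (p q : Prog) (σ τ : State) (t : ℕ) (hb : b.Holds σ)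
      (hp : Exec p σ t τ) : Exec (.ite b p q) σ (t + 1) τ
  | iteFalse (b : Test) (p q : Prog) (σ τ : State) (t : ℕ) (hb : ¬ b.Holds σ)
      (hq : Exec q σ t τ) : Exec (.ite b p q) σ (t + 1) τ
  | whileTrue (b : Test) (p : Prog) (σ τ ρ : State) (s t : ℕ) (hb : b.Holds σ)
      (hp : Exec p σ s τ) (hw : Exec (.while b p) τ t ρ) :
      Exec (.while b p) σ (s + t + 1) ρ
  | whileFalse (b : Test) (p : Prog) (σ : State) (hb : ¬ b.Holds σ) :
      Exec (.while b p) σ 1 σ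

/-- On the given input, `P` halts after exactly `t` steps, having written `output`. -/
def Computes (P : Prog) (input : List ℤ) (t : ℕ) (output : List ℤ) : Prop :=
  ∃ τ : State, Exec P (State.init input) t τ ∧ τ.out = output

end RAM

/-! ### Instances and answers of the minimum `k`-vertex-edge domination problem -/

namespace VEDom

/-- `L` lists every edge of `G` exactly once, in any order, each in one of its two
orientations. -/
def IsEdgeList {n : ℕ} (G : SimpleGraph (Fin n)) (L : List (Fin n × Fin n)) : Prop :=
  (L.map fun p => s(p.1, p.2)).Nodup ∧
    ∀ e : Sym2 (Fin n), e ∈ (L.map fun p => s(p.1, p.2)) ↔ e ∈ G.edgeSet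

/-- The input tape for a graph on `0, …, n - 1` with edge list `L`, and the integer `k`:
the numbers `n`, `|L|`, `k`, followed by the two ends of every edge in the list. -/
def encodeInstance (n : ℕ) (L : List (Fin n × Fin n)) (k : ℤ) : List ℤ :=
  (n : ℤ) :: (L.length : ℤ) :: k :: L.flatMap fun p => [((p.1 : ℕ) : ℤ), ((p.2 : ℕ) : ℤ)]

/-- `out` is a correct answer for `(G, k)`: either the number `1` followed by the vertices of a
minimum `k`-vertex-edge dominating set, each listed once; or the single number `0`, and `G` has
no `k`-vertex-edge dominating set. -/
def IsCorrectAnswer {n : ℕ} (G : SimpleGraph (Fin n)) (k : ℤ) (out : List ℤ) : Prop :=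
  (∃ l : List (Fin n), l.Nodup ∧ IsMinKVEDominating G k l.toFinset ∧
      out = 1 :: l.map fun v => ((v : ℕ) : ℤ)) ∨
    ((¬ ∃ D : Finset (Fin n), IsKVEDominating G k D) ∧ out = [0])

end VEDom

/-! ### Rooted trees -/

namespace VEDom

/-! Root the tree and treat a vertex `p` only after all its children. The edges from the children of
`p` down to their own children are then settled, and the edges between `p` and its children are
examined one by one. While the edge between `p` and a child `c` lacks elements, a vertex outside the
current set `D` is added, in this order of preference: the parent of `p`, `p` itself, a child of
`p`, a child of `c`. The preferred vertex counts for every unsettled edge for which another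
remaining candidate counts. In a minimum solution containing `D`, some candidate can therefore be
exchanged for it (`extendable_insert` and its four instances in a rooted tree). So `D` always
extends to a minimum solution, provided that solutions exist. If candidates run out, all of `N[c] ∪
N[p]` is in `D` and there is no solution; if all edges get dominated, `D` itself is minimum
(`IsRooting.isMin`).

For linear time, the number of missing elements is read off from counters of chosen children
(`Recorded.cover_eq`), and every vertex has a linked list of its children that have not been
considered. A greedy step chooses `p` or its parent, shortens the list of `p` or of `c`, or fails
and ends the work on the edge. Hence the work at `p` is bounded through `potential` by a constant
plus multiples of the numbers of children and grandchildren of `p`, and these add up to `O(n)`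
(`sum_weight_le`).

The bottom-up order needs no adjacency lists: each vertex stores its degree and the sum of the
addresses of its neighbours in the remaining tree, and for a leaf this sum is the address of its
parent. A single scan, climbing from each leaf as long as the parent becomes a leaf, removes all
vertices (`climb_spec`, `Pruned.eq_univ`). -/

/-- `par` assigns to every vertex of `G` except one root its parent, and `G` has the edges from
vertices to their parents only. -/
structure IsRooting {V : Type*} (G : SimpleGraph V) (r : V) (par : V → Option V)
    (depth : V → ℕ) : Prop where
  adj_iff : ∀ u v, G.Adj u v ↔ par u = some v ∨ par v = some u
  depth_eq : ∀ u v, par u = some v → depth u = depth v + 1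
  par_eq_none : ∀ u, par u = none ↔ u = r

/-- The parent of `u` is the second vertex of the unique path from `u` to `r`, and the depth is the
distance to `r`. In a tree the distances of adjacent vertices to `r` differ by exactly one, so every
edge joins a vertex to its parent. -/
theorem exists_isRooting {V : Type*} {G : SimpleGraph V} (hG : G.IsTree) (r : V) :
    ∃ par depth, IsRooting G r par depth := by
  classical
  have hex : ∀ u, ∃ p : G.Walk u r, p.IsPath ∧ p.length = G.dist u r := fun u =>
    hG.connected.exists_path_of_dist u r
  choose f hf hlen using hex
  have huniq : ∀ u (p : G.Walk u r), p.IsPath → p = f u := fun u p hp =>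
    (hG.existsUnique_path u r).unique hp (hf u)
  have hsnd : ∀ u v, G.Adj u v → G.dist u r = G.dist v r + 1 → (f u).snd = v := by
    intro u v huv h
    have hp : (SimpleGraph.Walk.cons huv (f v)).IsPath :=
      SimpleGraph.Walk.isPath_of_length_eq_dist _ (by simp [hlen, h])
    rw [← huniq u _ hp]
    simp
  have hadj : ∀ u, u ≠ r → G.Adj u (f u).snd := fun u hu =>
    SimpleGraph.Walk.adj_snd (SimpleGraph.Walk.not_nil_of_ne hu)
  have hdist : ∀ u v, G.Adj u v → G.dist u r = G.dist v r + 1 ∨ G.dist v r = G.dist u r + 1 := by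
    intro u v huv
    have := hG.dist_eq_dist_add_one_of_adj r huv
    simpa only [SimpleGraph.dist_comm] using this
  have hsnd' : ∀ u, u ≠ r → G.dist u r = G.dist (f u).snd r + 1 := by
    intro u hu
    have hnil : ¬ (f u).Nil := SimpleGraph.Walk.not_nil_of_ne hu
    have h1 : (f u).tail = f (f u).snd := huniq _ _ (hf u).tail
    have h2 := SimpleGraph.Walk.length_tail_add_one hnil
    rw [h1, hlen, hlen] at h2
    exact h2.symm
  refine ⟨fun u => if u = r then none else some (f u).snd, fun u => G.dist u r, ?_, ?_, ?_⟩
  · intro u v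
    constructor
    · intro huv
      rcases hdist u v huv with h | h
      · left
        have hu : u ≠ r := by rintro rfl; simp at h
        simp [hu, hsnd u v huv h]
      · right
        have hv : v ≠ r := by rintro rfl; simp at h
        simp [hv, hsnd v u huv.symm h]
    · rintro (h | h)
      · by_cases hu : u = r
        · simp [hu] at h
        · simp only [hu, if_false, Option.some.injEq] at h
          exact h ▸ hadj u hu
      · by_cases hv : v = r
        · simp [hv] at h
        · simp only [hv, if_false, Option.some.injEq] at h
          exact (h ▸ hadj v hv).symm
  · intro u v h
    by_cases hu : u = r
    · simp [hu] at h
    · simp only [hu, if_false, Option.some.injEq] at h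
      exact h ▸ hsnd' u hu
  · intro u
    by_cases hu : u = r <;> simp [hu]

/-! ### The greedy exchange -/

/-- The number of elements of `D` that count for the edge `uv`. -/
noncomputable def cover {V : Type*} (G : SimpleGraph V) (D : Finset V) (u v : V) : ℕ :=
  ((closedNbhd G u ∪ closedNbhd G v) ∩ (D : Set V)).ncard

/-- If there is a `k`-vertex-edge dominating set at all, then `D` extends to a minimum one. -/
def Extendable {V : Type*} (G : SimpleGraph V) (k : ℤ) (D : Finset V) : Prop :=
  (∃ D', IsKVEDominating G k D') → ∃ D', IsMinKVEDominating G k D' ∧ D ⊆ D'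

section

variable {V : Type*} {G : SimpleGraph V} {k : ℤ} {D : Finset V} {u v : V}

theorem cover_comm (G : SimpleGraph V) (D : Finset V) (u v : V) :
    cover G D u v = cover G D v u := by
  rw [cover, cover, Set.union_comm]

theorem isKVEDominating_iff : IsKVEDominating G k D ↔ ∀ u v, G.Adj u v → k ≤ cover G D u v :=
  Iff.rfl

theorem cover_mono {D' : Finset V} (h : D ⊆ D') : cover G D u v ≤ cover G D' u v :=
  Set.ncard_le_ncard (Set.inter_subset_inter_right _ (by exact_mod_cast h))
    (D'.finite_toSet.subset Set.inter_subset_right)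

theorem extendable_empty (G : SimpleGraph V) (k : ℤ) : Extendable G k ∅ := by
  classical
  rintro ⟨D', hD'⟩
  have h : ∃ m, ∃ D', IsKVEDominating G k D' ∧ D'.card = m := ⟨_, D', hD', rfl⟩
  obtain ⟨D₀, h₀, hm⟩ := Nat.find_spec h
  exact ⟨D₀, ⟨h₀, fun E hE => hm ▸ Nat.find_min' h ⟨E, hE, rfl⟩⟩, Finset.empty_subset _⟩

/-- A dominating set contained in a minimum one is no larger than it. -/
theorem Extendable.isMin (h : Extendable G k D) (hD : IsKVEDominating G k D) :
    IsMinKVEDominating G k D := by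
  obtain ⟨D', hmin, hsub⟩ := h ⟨D, hD⟩
  exact ⟨hD, fun E hE => (Finset.card_le_card hsub).trans (hmin.2 E hE)⟩

/-- Exchange argument: a minimum solution `E ⊇ D` without `x` has an element `y ∉ D` that counts for
the deficient edge, and `y` can be replaced by `x`. By `hdom`, every edge that is not yet dominated
and loses `y` gains `x`. -/
theorem extendable_insert [DecidableEq V] (h : Extendable G k D) (huv : G.Adj u v)
    (hdef : (cover G D u v : ℤ) < k) {x : V} (hx : x ∉ D)
    (hdom : ∀ y, y ∈ closedNbhd G u ∪ closedNbhd G v → y ∉ D → ∀ a b, G.Adj a b →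
      y ∈ closedNbhd G a ∪ closedNbhd G b → (cover G D a b : ℤ) < k →
        x ∈ closedNbhd G a ∪ closedNbhd G b) :
    Extendable G k (insert x D) := by
  intro hex
  obtain ⟨E, hmin, hsub⟩ := h hex
  by_cases hxE : x ∈ E
  · exact ⟨E, hmin, Finset.insert_subset hxE hsub⟩
  obtain ⟨y, hyN, hyE, hyD⟩ : ∃ y, y ∈ closedNbhd G u ∪ closedNbhd G v ∧ y ∈ E ∧ y ∉ D := by
    -- Otherwise `E` would cover `uv` no better than `D` does.
    by_contra! hno
    have : cover G E u v ≤ cover G D u v :=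
      Set.ncard_le_ncard (fun y hy => ⟨hy.1, hno y hy.1 hy.2⟩)
        (D.finite_toSet.subset Set.inter_subset_right)
    have := hmin.1 u v huv
    change k ≤ (cover G E u v : ℤ) at this
    omega
  have hxy : x ≠ y := fun e => hxE (e ▸ hyE)
  have hsub' : insert x D ⊆ insert x (E.erase y) :=
    Finset.insert_subset_insert _ fun z hz =>
      Finset.mem_erase.2 ⟨fun e : z = y => hyD (e ▸ hz), hsub hz⟩
  have hcard : (insert x (E.erase y)).card = E.card := by
    rw [Finset.card_insert_of_notMem (fun h => hxE (Finset.mem_of_mem_erase h)),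
      Finset.card_erase_add_one hyE]
  refine ⟨insert x (E.erase y), ⟨?_, fun E' hE' => hcard ▸ hmin.2 E' hE'⟩, hsub'⟩
  intro a b hab
  change k ≤ (cover G _ a b : ℤ)
  -- Edges dominated by `D` alone are safe, because the exchange keeps all of `D`.
  by_cases hk : k ≤ (cover G D a b : ℤ)
  · exact hk.trans (by exact_mod_cast cover_mono ((Finset.subset_insert _ _).trans hsub'))
  have hE : k ≤ (cover G E a b : ℤ) := hmin.1 a b hab
  refine hE.trans ?_
  norm_cast
  by_cases hyab : y ∈ closedNbhd G a ∪ closedNbhd G b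
  · have hxab := hdom y hyN hyD a b hab hyab (not_le.1 hk)
    have heq : (closedNbhd G a ∪ closedNbhd G b) ∩ ((insert x (E.erase y) : Finset V) : Set V) =
        insert x (((closedNbhd G a ∪ closedNbhd G b) ∩ (E : Set V)) \ {y}) := by
      ext z
      by_cases hzx : z = x
      · subst hzx; simp [hxab]
      · simp [hzx]; tauto
    unfold cover
    have hfin : ((closedNbhd G a ∪ closedNbhd G b) ∩ (E : Set V)).Finite :=
      E.finite_toSet.subset Set.inter_subset_right
    rw [heq, Set.ncard_insert_of_notMem (fun h => hxE h.1.2) hfin.sdiff,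
      Set.ncard_sdiff_singleton_add_one (Set.mem_inter hyab (by exact_mod_cast hyE)) hfin]
  · refine Set.ncard_le_ncard (fun z hz => ⟨hz.1, ?_⟩)
      ((Finset.finite_toSet _).subset Set.inter_subset_right)
    have : z ≠ y := fun e => hyab (e ▸ hz.1)
    simp [this, Finset.mem_coe.1 hz.2]

theorem not_exists_isKVEDominating (huv : G.Adj u v) (hdef : (cover G D u v : ℤ) < k)
    (hall : closedNbhd G u ∪ closedNbhd G v ⊆ (D : Set V)) :
    ¬ ∃ D', IsKVEDominating G k D' := by
  rintro ⟨E, hE⟩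
  have h1 : k ≤ (cover G E u v : ℤ) := hE u v huv
  have h2 : cover G E u v ≤ cover G D u v :=
    Set.ncard_le_ncard (fun y hy => ⟨hy.1, hall hy.1⟩)
      (D.finite_toSet.subset Set.inter_subset_right)
  omega

end

end VEDom

/-! ### Greedy choices in a rooted tree -/

namespace VEDom

/-- `1` for the vertices in `D`, and `0` otherwise, also for a missing vertex. -/
def indicator {V : Type*} [DecidableEq V] (D : Finset V) (o : Option V) : ℤ :=
  o.elim 0 fun q => if q ∈ D then 1 else 0

/-- The children of a vertex; the children of `none` are the roots. -/
def children {V : Type*} [Fintype V] [DecidableEq V] (par : V → Option V) (o : Option V) :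
    Finset V :=
  Finset.univ.filter fun c => par c = o

section

variable {V : Type*} {G : SimpleGraph V} {r : V}
  {par : V → Option V} {depth : V → ℕ} {k : ℤ} {D F : Finset V} {v p x q : V}

@[simp] theorem mem_children [Fintype V] [DecidableEq V] {o : Option V} :
    x ∈ children par o ↔ par x = o := by
  simp [children]

@[simp] theorem indicator_none [DecidableEq V] : indicator D none = 0 := rfl

@[simp] theorem indicator_some [DecidableEq V] :
    indicator D (some q) = if q ∈ D then 1 else 0 := rfl

/-- The vertex `v` needs no alternative of its own, being a child of `p`. -/
theorem IsRooting.mem_nbhd (h : IsRooting G r par depth) (hv : par v = some p) :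
    x ∈ closedNbhd G v ∪ closedNbhd G p ↔
      par x = some v ∨ par x = some p ∨ x = p ∨ par p = some x := by
  simp only [closedNbhd, Set.mem_union, Set.mem_insert_iff, SimpleGraph.mem_neighborSet,
    h.adj_iff, hv, Option.some.injEq]
  constructor
  · grind
  · grind

/-- The relevant vertices lie two or one levels below `p`, at `p`, or one level above, so depth
makes the four kinds disjoint. -/
theorem IsRooting.cover_eq [Fintype V] [DecidableEq V] (h : IsRooting G r par depth)
    (hv : par v = some p) :
    (cover G D v p : ℤ) = (children par (some v) ∩ D).card + (children par (some p) ∩ D).card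
      + indicator D (some p) + indicator D (par p) := by
  have hd := h.depth_eq v p hv
  have h1 : Disjoint (children par (some v) ∩ D) (children par (some p) ∩ D) := by
    rw [Finset.disjoint_left]
    intro x hx hx'
    simp only [Finset.mem_inter, mem_children] at hx hx'
    have := hx.1.symm.trans hx'.1
    simp only [Option.some.injEq] at this
    subst this
    omega
  have h2 : Disjoint (children par (some v) ∩ D ∪ children par (some p) ∩ D) ({p} ∩ D) := by
    rw [Finset.disjoint_left]
    intro x hx hx'
    simp only [Finset.mem_union, Finset.mem_inter, mem_children, Finset.mem_singleton] at hx hx'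
    obtain ⟨rfl, -⟩ := hx'
    rcases hx with hx | hx <;> have := h.depth_eq _ _ hx.1 <;> omega
  have h3 : Disjoint (children par (some v) ∩ D ∪ children par (some p) ∩ D ∪ {p} ∩ D)
      ((par p).toFinset ∩ D) := by
    rw [Finset.disjoint_left]
    intro x hx hx'
    simp only [Finset.mem_union, Finset.mem_inter, mem_children, Finset.mem_singleton,
      Option.mem_toFinset, Option.mem_def] at hx hx'
    have h4 := h.depth_eq _ _ hx'.1
    rcases hx with (hx | hx) | hx
    · have := h.depth_eq _ _ hx.1; omega
    · have := h.depth_eq _ _ hx.1; omega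
    · obtain ⟨rfl, -⟩ := hx; omega
  have hset : (closedNbhd G v ∪ closedNbhd G p) ∩ (D : Set V) =
      ((children par (some v) ∩ D ∪ children par (some p) ∩ D ∪ {p} ∩ D ∪
        (par p).toFinset ∩ D : Finset V) : Set V) := by
    ext x
    rw [Set.mem_inter_iff, h.mem_nbhd hv]
    simp only [Finset.coe_union, Finset.coe_inter, Set.mem_union, Set.mem_inter_iff,
      Finset.mem_coe, mem_children, Finset.mem_singleton, Option.mem_toFinset, Option.mem_def]
    tauto
  rw [cover, hset, Set.ncard_coe_finset, Finset.card_union_of_disjoint h3,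
    Finset.card_union_of_disjoint h2, Finset.card_union_of_disjoint h1]
  have h5 : ((({p} : Finset V) ∩ D).card : ℤ) = indicator D (some p) := by
    by_cases hp : p ∈ D <;> simp [hp]
  have h6 : (((par p).toFinset ∩ D).card : ℤ) = indicator D (par p) := by
    cases hpp : par p with
    | none => simp
    | some q => by_cases hq : q ∈ D <;> simp [hq]
  push_cast
  rw [h5, h6]

/-- All edges from children to vertices in `F` are dominated, and `F` is closed under taking
children. -/
structure Settled (G : SimpleGraph V) (par : V → Option V) (k : ℤ) (D F : Finset V) : Prop where
  closed : ∀ a b, par a = some b → b ∈ F → a ∈ F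
  dominated : ∀ a b, par a = some b → b ∈ F → k ≤ cover G D a b

theorem Settled.mono (h : Settled G par k D F) {D' : Finset V} (hD : D ⊆ D') :
    Settled G par k D' F :=
  ⟨h.closed, fun a b hab hb => (h.dominated a b hab hb).trans (by exact_mod_cast cover_mono hD)⟩

/-- Edges with upper end in `F` are dominated already, so the exchange has to be safe only for edges
with upper end outside `F`. -/
theorem IsRooting.extendable_insert [DecidableEq V] (h : IsRooting G r par depth)
    (hF : Settled G par k D F)
    (hE : Extendable G k D) (hv : par v = some p) (hdef : (cover G D v p : ℤ) < k) (hx : x ∉ D)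
    (hdom : ∀ y, (par y = some v ∨ par y = some p ∨ y = p ∨ par p = some y) → y ∉ D →
      ∀ a b, par a = some b → b ∉ F →
        (par y = some a ∨ par y = some b ∨ y = b ∨ par b = some y) →
          (par x = some a ∨ par x = some b ∨ x = b ∨ par b = some x)) :
    Extendable G k (insert x D) := by
  have key : ∀ y, y ∈ closedNbhd G v ∪ closedNbhd G p → y ∉ D → ∀ a b, par a = some b →
      y ∈ closedNbhd G a ∪ closedNbhd G b → (cover G D a b : ℤ) < k →
        x ∈ closedNbhd G a ∪ closedNbhd G b := by
    intro y hy hyD a b hab hyab hk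
    rw [h.mem_nbhd hv] at hy
    rw [h.mem_nbhd hab] at hyab ⊢
    exact hdom y hy hyD a b hab (fun hb => not_lt.2 (hF.dominated a b hab hb) hk) hyab
  refine VEDom.extendable_insert hE ((h.adj_iff _ _).2 (Or.inl hv)) hdef hx ?_
  intro y hy hyD a b hab hyab hk
  rcases (h.adj_iff _ _).1 hab with h' | h'
  · exact key y hy hyD a b h' hyab hk
  · rw [Set.union_comm] at hyab ⊢
    rw [cover_comm] at hk
    exact key y hy hyD b a h' hyab hk

/-- An unsettled edge for which a candidate other than `q` counts has `p` or `q` as an end, and `q`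
counts for all such edges. -/
theorem IsRooting.extendable_insert_parent [DecidableEq V] (h : IsRooting G r par depth)
    (hF : Settled G par k D F) (hE : Extendable G k D) (hp : ∀ c, par c = some p → c ∈ F)
    (hv : par v = some p) (hdef : (cover G D v p : ℤ) < k) (hq : par p = some q) (hx : q ∉ D) :
    Extendable G k (insert q D) := by
  refine h.extendable_insert hF hE hv hdef hx ?_
  intro y hy _ a b hab hb hyab
  have hc := hF.closed
  have := hp v hv
  grind

/-- With the parent chosen, the other candidates lie below `p`, and the unsettled edges for which
they count all have `p` as an end. -/
theorem IsRooting.extendable_insert_self [DecidableEq V] (h : IsRooting G r par depth)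
    (hF : Settled G par k D F) (hE : Extendable G k D) (hp : ∀ c, par c = some p → c ∈ F)
    (hv : par v = some p) (hdef : (cover G D v p : ℤ) < k) (hq : ∀ q, par p = some q → q ∈ D)
    (hx : p ∉ D) :
    Extendable G k (insert p D) := by
  refine h.extendable_insert hF hE hv hdef hx ?_
  intro y hy _ a b hab hb hyab
  have hc := hF.closed
  have := hp v hv
  grind

/-- The candidates left are the children of `p`, which count for the same unsettled edges, namely
those at `p`, and the children of `v`, which count for no unsettled edge except `vp`. -/
theorem IsRooting.extendable_insert_sibling [DecidableEq V] (h : IsRooting G r par depth)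
    (hF : Settled G par k D F) (hE : Extendable G k D) (hp : ∀ c, par c = some p → c ∈ F)
    (hv : par v = some p) (hdef : (cover G D v p : ℤ) < k) (hq : ∀ q, par p = some q → q ∈ D)
    (hpD : p ∈ D) (hxp : par x = some p) (hx : x ∉ D) :
    Extendable G k (insert x D) := by
  refine h.extendable_insert hF hE hv hdef hx ?_
  intro y hy _ a b hab hb hyab
  have hc := hF.closed
  have := hp v hv
  grind

/-- Only children of `v` are left, and `vp` is the one unsettled edge for which they count. -/
theorem IsRooting.extendable_insert_child [DecidableEq V] (h : IsRooting G r par depth)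
    (hF : Settled G par k D F) (hE : Extendable G k D) (hp : ∀ c, par c = some p → c ∈ F)
    (hv : par v = some p) (hdef : (cover G D v p : ℤ) < k) (hq : ∀ q, par p = some q → q ∈ D)
    (hpD : p ∈ D) (hcD : ∀ c, par c = some p → c ∈ D) (hxv : par x = some v) (hx : x ∉ D) :
    Extendable G k (insert x D) := by
  refine h.extendable_insert hF hE hv hdef hx ?_
  intro y hy _ a b hab hb hyab
  have hc := hF.closed
  have := hp v hv
  grind

theorem IsRooting.not_exists (h : IsRooting G r par depth) (hv : par v = some p)
    (hdef : (cover G D v p : ℤ) < k) (hq : ∀ q, par p = some q → q ∈ D) (hpD : p ∈ D)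
    (hcD : ∀ c, par c = some p → c ∈ D) (hvD : ∀ c, par c = some v → c ∈ D) :
    ¬ ∃ D', IsKVEDominating G k D' := by
  refine not_exists_isKVEDominating ((h.adj_iff _ _).2 (Or.inl hv)) hdef fun x hx => ?_
  rw [h.mem_nbhd hv] at hx
  rcases hx with hx | hx | rfl | hx
  exacts [hvD x hx, hcD x hx, hpD, hq x hx]

theorem IsRooting.isMin [Fintype V] (h : IsRooting G r par depth)
    (hF : Settled G par k D Finset.univ)
    (hE : Extendable G k D) : IsMinKVEDominating G k D := by
  refine hE.isMin (isKVEDominating_iff.2 fun u v huv => ?_)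
  rcases (h.adj_iff _ _).1 huv with h' | h'
  · exact hF.dominated u v h' (Finset.mem_univ _)
  · rw [cover_comm]
    exact hF.dominated v u h' (Finset.mem_univ _)

end

end VEDom

/-! ### Reasoning about programs -/

namespace RAM

/-- Started in `σ` with the budget `b`, the program halts within the budget in a state which
satisfies `Q` together with some part of the remaining budget. -/
def Runs (P : Prog) (σ : State) (b : ℕ) (Q : State → ℕ → Prop) : Prop :=
  ∃ t τ b', Exec P σ t τ ∧ t + b' ≤ b ∧ Q τ b'

theorem Runs.seq {p q : Prog} {σ : State} {b : ℕ} {Q : State → ℕ → Prop}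
    (h : Runs p σ b fun τ b' => Runs q τ b' Q) : Runs (p.seq q) σ b Q := by
  obtain ⟨s, τ, b', hp, hb, t, ρ, b'', hq, hb', hQ⟩ := h
  exact ⟨s + t, ρ, b'', .seq _ _ _ _ _ _ _ hp hq, by omega, hQ⟩

theorem Runs.mono {p : Prog} {σ : State} {b c : ℕ} {Q R : State → ℕ → Prop}
    (h : Runs p σ b Q) (hbc : b ≤ c) (hQR : ∀ τ b', Q τ b' → R τ b') : Runs p σ c R := by
  obtain ⟨s, τ, b', hp, hb, hQ⟩ := h
  exact ⟨s, τ, b', hp, by omega, hQR _ _ hQ⟩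

theorem Runs.ite {B : Test} {p q : Prog} {σ : State} {b : ℕ} {Q : State → ℕ → Prop}
    (hp : B.Holds σ → Runs p σ b Q) (hq : ¬ B.Holds σ → Runs q σ b Q) :
    Runs (.ite B p q) σ (b + 1) Q := by
  by_cases hB : B.Holds σ
  · obtain ⟨t, τ, b', he, hb, hQ⟩ := hp hB
    exact ⟨t + 1, τ, b', .iteTrue _ _ _ _ _ _ hB he, by omega, hQ⟩
  · obtain ⟨t, τ, b', he, hb, hQ⟩ := hq hB
    exact ⟨t + 1, τ, b', .iteFalse _ _ _ _ _ _ hB he, by omega, hQ⟩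

/-- The budget is the termination measure, since each test costs a unit. As the invariant may
mention the budget, amortised bounds need no separate counting of iterations. -/
theorem Runs.loop {B : Test} {p : Prog} {Q : State → ℕ → Prop} (I : State → ℕ → Prop)
    (hstep : ∀ σ b, I σ b → B.Holds σ → ∃ b₀, b₀ + 1 ≤ b ∧ Runs p σ b₀ I)
    (hexit : ∀ σ b, I σ b → ¬ B.Holds σ → ∃ b₀, b₀ + 1 ≤ b ∧ Q σ b₀) :
    ∀ {σ b}, I σ b → Runs (.while B p) σ b Q := by
  intro σ b
  induction b using Nat.strong_induction_on generalizing σ with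
  | _ b ih =>
    intro hI
    by_cases hB : B.Holds σ
    · obtain ⟨b₀, hb₀, s, τ, b', hp, hb, hI'⟩ := hstep σ b hI hB
      obtain ⟨t, ρ, b'', hw, hb', hQ⟩ := ih b' (by omega) hI'
      exact ⟨s + t + 1, ρ, b'', .whileTrue _ _ _ _ _ _ _ hB hp hw, by omega, hQ⟩
    · obtain ⟨b₀, hb₀, hQ⟩ := hexit σ b hI hB
      exact ⟨1, σ, b₀, .whileFalse _ _ _ hB, by omega, hQ⟩

open Classical in
/-- The weakest precondition of a loop-free program. -/
noncomputable def Prog.wp : Prog → (State → Prop) → State → Prop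
  | .skip, Q, σ => Q σ
  | .const r z, Q, σ => Q (σ.setReg r z)
  | .copy r a, Q, σ => Q (σ.setReg r (σ.reg a))
  | .add r a b, Q, σ => Q (σ.setReg r (σ.reg a + σ.reg b))
  | .sub r a b, Q, σ => Q (σ.setReg r (σ.reg a - σ.reg b))
  | .load r a, Q, σ => 0 ≤ σ.reg a ∧ Q (σ.setReg r (σ.mem (σ.reg a).toNat))
  | .store a b, Q, σ => 0 ≤ σ.reg a ∧ Q (σ.setMem (σ.reg a).toNat (σ.reg b))
  | .read r, Q, σ => ∃ z rest, σ.inp = z :: rest ∧ Q { σ.setReg r z with inp := rest }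
  | .write a, Q, σ => Q { σ with out := σ.out ++ [σ.reg a] }
  | .seq p q, Q, σ => p.wp (q.wp Q) σ
  | .ite b p q, Q, σ => if b.Holds σ then p.wp Q σ else q.wp Q σ
  -- Loops are left to `Runs.loop`; hence the value of `Prog.cost` on a loop is irrelevant.
  | .while _ _, _, _ => False

/-- The maximal number of steps of a loop-free program. -/
def Prog.cost : Prog → ℕ
  | .seq p q => p.cost + q.cost
  | .ite _ p q => max p.cost q.cost + 1
  | _ => 1

theorem Runs.of_wp {Q : State → ℕ → Prop} {P : Prog} {σ : State} {b b' : ℕ}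
    (h : P.wp (fun τ => Q τ b') σ) (hb : P.cost + b' ≤ b) : Runs P σ b Q := by
  suffices ∀ (P : Prog) (R : State → Prop) (σ : State), P.wp R σ →
      ∃ t τ, Exec P σ t τ ∧ t ≤ P.cost ∧ R τ by
    obtain ⟨t, τ, he, ht, hR⟩ := this P _ σ h
    exact ⟨t, τ, b', he, by omega, hR⟩
  clear h hb
  intro P
  induction P with
  | skip => exact fun R σ h => ⟨1, _, .skip _, le_rfl, h⟩
  | const r z => exact fun R σ h => ⟨1, _, .const _ _ _, le_rfl, h⟩
  | copy r a => exact fun R σ h => ⟨1, _, .copy _ _ _, le_rfl, h⟩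
  | add r a b => exact fun R σ h => ⟨1, _, .add _ _ _ _, le_rfl, h⟩
  | sub r a b => exact fun R σ h => ⟨1, _, .sub _ _ _ _, le_rfl, h⟩
  | load r a =>
    exact fun R σ h => ⟨1, _, .load _ _ _ _ (Int.toNat_of_nonneg h.1).symm, le_rfl, h.2⟩
  | store a b =>
    exact fun R σ h => ⟨1, _, .store _ _ _ _ (Int.toNat_of_nonneg h.1).symm, le_rfl, h.2⟩
  | read r =>
    rintro R σ ⟨z, rest, hi, h⟩
    exact ⟨1, _, .read _ _ _ _ hi, le_rfl, h⟩
  | write a => exact fun R σ h => ⟨1, _, .write _ _, le_rfl, h⟩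
  | seq p q ihp ihq =>
    intro R σ h
    obtain ⟨s, τ, hp, hs, h'⟩ := ihp _ σ h
    obtain ⟨t, ρ, hq, ht, hR⟩ := ihq _ τ h'
    exact ⟨s + t, ρ, .seq _ _ _ _ _ _ _ hp hq, by simp only [Prog.cost]; omega, hR⟩
  | ite b p q ihp ihq =>
    intro R σ h
    by_cases hb : b.Holds σ
    · obtain ⟨s, τ, hp, hs, hR⟩ := ihp _ σ (by simpa only [Prog.wp, if_pos hb] using h)
      exact ⟨s + 1, τ, .iteTrue _ _ _ _ _ _ hb hp, by simp only [Prog.cost]; omega, hR⟩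
    · obtain ⟨s, τ, hp, hs, hR⟩ := ihq _ σ (by simpa only [Prog.wp, if_neg hb] using h)
      exact ⟨s + 1, τ, .iteFalse _ _ _ _ _ _ hb hp, by simp only [Prog.cost]; omega, hR⟩
  | _ => exact fun R σ h => h.elim

theorem Prog.wp_mono {P : Prog} {Q R : State → Prop} {σ : State} (h : P.wp Q σ)
    (hQR : ∀ τ, Q τ → R τ) : P.wp R σ := by
  induction P generalizing Q R σ with
  | load r a => exact ⟨h.1, hQR _ h.2⟩
  | store a b => exact ⟨h.1, hQR _ h.2⟩
  | read r =>
    obtain ⟨z, rest, hi, h⟩ := h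
    exact ⟨z, rest, hi, hQR _ h⟩
  | seq p q ihp ihq => exact ihp h fun τ hτ => ihq hτ hQR
  | ite b p q ihp ihq =>
    by_cases hb : b.Holds σ
    · simp only [Prog.wp, if_pos hb] at h ⊢
      exact ihp h hQR
    · simp only [Prog.wp, if_neg hb] at h ⊢
      exact ihq h hQR
  | skip | const | copy | add | sub | write => exact hQR _ h
  | _ => exact h.elim

end RAM

/-! ### Records in memory -/

namespace VEDom

open RAM

/-- The entries of the record of a vertex. -/
inductive Field where
  | deg
  | sum
  | ind
  | cnt
  | head
  | next

/-- The position of an entry in a record. -/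
def Field.offset : Field → ℕ
  | .deg => 0
  | .sum => 1
  | .ind => 2
  | .cnt => 3
  | .head => 4
  | .next => 5

section

variable {n : ℕ}

/-- The address of the record of a vertex; the missing vertex has a record at address `0`. -/
def base : Option (Fin n) → ℕ
  | none => 0
  -- Six words would suffice, but a factor of eight is computed by three doublings. Address `0`
  -- doubles as the null pointer.
  | some v => 8 * ((v : ℕ) + 1)

/-- The address of an entry. -/
def addr (j : Field) (o : Option (Fin n)) : ℕ := base o + j.offset

@[simp] theorem base_none : base (none : Option (Fin n)) = 0 := rfl

theorem base_some (v : Fin n) : base (some v) = 8 * ((v : ℕ) + 1) := rfl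

@[simp] theorem base_some_pos (v : Fin n) : 0 < base (some v) := by simp [base_some]

@[simp] theorem base_inj {o o' : Option (Fin n)} : base o = base o' ↔ o = o' := by
  cases o <;> cases o' <;> simp [base, Fin.ext_iff]

@[simp] theorem base_eq_zero {o : Option (Fin n)} : base o = 0 ↔ o = none := by
  cases o <;> simp [base]

-- Bases are multiples of eight and offsets are below eight, so records do not overlap.
@[simp] theorem addr_inj {j j' : Field} {o o' : Option (Fin n)} :
    addr j o = addr j' o' ↔ j = j' ∧ o = o' := by
  constructor
  · intro h
    have hb : ∀ o : Option (Fin n), ∃ i, base o = 8 * i := fun o => by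
      cases o <;> simp [base]
    obtain ⟨i, hi⟩ := hb o
    obtain ⟨i', hi'⟩ := hb o'
    have hj : j = j' := by
      cases j <;> cases j' <;> simp [addr, Field.offset] at h ⊢ <;> omega
    subst hj
    exact ⟨rfl, base_inj.1 (by simpa [addr] using h)⟩
  · rintro ⟨rfl, rfl⟩; rfl

@[simp] theorem base_add_offset_nonneg (o : Option (Fin n)) (j : Field) :
    0 ≤ (base o : ℤ) + (j.offset : ℤ) := by positivity

@[simp] theorem toNat_base_add_offset (o : Option (Fin n)) (j : Field) :
    ((base o : ℤ) + (j.offset : ℤ)).toNat = addr j o := by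
  simp only [addr]; omega

end

/-- Load an entry of the record that register `s` points to. -/
def getField (r s : ℕ) (j : Field) : Prog :=
  .seq (.const 0 j.offset) (.seq (.add 0 s 0) (.load r 0))

/-- Store into an entry of the record that register `s` points to. -/
def putField (s : ℕ) (j : Field) (r : ℕ) : Prog :=
  .seq (.const 0 j.offset) (.seq (.add 0 s 0) (.store 0 r))

/-- Add a register to an entry. -/
def addField (s : ℕ) (j : Field) (r : ℕ) : Prog :=
  .seq (getField 10 s j) (.seq (.add 10 10 r) (putField s j 10))

/-- Subtract a register from an entry. -/
def subField (s : ℕ) (j : Field) (r : ℕ) : Prog :=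
  .seq (getField 10 s j) (.seq (.sub 10 10 r) (putField s j 10))

/-! ### The program -/

/-- Take the first element off the list of the vertex in register `s`, and choose it if it has
not been chosen yet. -/
def popChild (s : ℕ) : Prog :=
  .seq (getField 12 11 .next) (.seq (putField s .head 12) (.seq (getField 10 11 .ind)
    (.ite (.eq 10 1)
      (.seq (putField 11 .ind 2) (.seq (addField s .cnt 2) (.sub 9 9 2)))
      .skip)))

/-- One greedy choice for the edge between the vertices in registers `8` and `6`, where
register `7` holds the parent of the vertex in register `6`. -/
def chooseOne : Prog :=
  -- A missing parent is treated as already chosen.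
  .seq (.seq (getField 10 7 .ind) (.ite (.eq 7 1) (.copy 10 2) .skip))
    (.ite (.eq 10 1) (.seq (putField 7 .ind 2) (.sub 9 9 2))
      (.seq (getField 10 6 .ind)
        (.ite (.eq 10 1) (.seq (putField 6 .ind 2) (.sub 9 9 2))
          (.seq (getField 11 6 .head)
            (.ite (.lt 1 11) (popChild 6)
              (.seq (getField 11 8 .head)
                (.ite (.lt 1 11) (popChild 8)
                  -- No candidate is left: raise the flag in register `13`, and clear the need in
                  -- register `9` to leave the loop.
                  (.seq (.copy 13 2) (.copy 9 1)))))))))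

/-- The registers in `S` and the tapes are the same in two states. -/
def Keeps (S : List ℕ) (σ τ : State) : Prop :=
  (∀ r ∈ S, τ.reg r = σ.reg r) ∧ τ.inp = σ.inp ∧ τ.out = σ.out

theorem Keeps.trans {S : List ℕ} {σ τ ρ : State} (h : Keeps S σ τ) (h' : Keeps S τ ρ) :
    Keeps S σ ρ :=
  ⟨fun r hr => (h'.1 r hr).trans (h.1 r hr), h'.2.1.trans h.2.1, h'.2.2.trans h.2.2⟩

theorem Keeps.refl (S : List ℕ) (σ : State) : Keeps S σ σ := ⟨fun _ _ => rfl, rfl, rfl⟩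

theorem Keeps.subset {S S' : List ℕ} {σ τ : State} (h : Keeps S σ τ) (hS : S' ⊆ S) :
    Keeps S' σ τ :=
  ⟨fun r hr => h.1 r (hS hr), h.2⟩

/-- Registers that keep their values while an edge is processed. -/
abbrev edgeRegs : List ℕ := [1, 2, 3, 4, 5, 6, 7, 8, 14]

/-- The registers `1` and `2` hold constants, and `6`, `7` and `8` point to `p`, to `q`, and
to `c`. -/
structure AtEdge {n : ℕ} (σ : State) (p : Fin n) (q : Option (Fin n)) (c : Fin n) : Prop where
  zero : σ.reg 1 = 0
  one : σ.reg 2 = 1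
  vertex : σ.reg 6 = base (some p)
  parent : σ.reg 7 = base q
  child : σ.reg 8 = base (some c)

/-! ### Symbolic execution of one greedy choice, branch by branch. -/

section

variable {n : ℕ} {σ : State} {p c x : Fin n} {q : Option (Fin n)}

attribute [local simp] State.setReg State.setMem Prog.wp Test.Holds Function.update_apply
  getField putField addField subField popChild chooseOne Keeps

theorem wp_chooseOne_parent {q : Fin n} (h : AtEdge σ p (some q) c)
    (hq : σ.mem (addr .ind (some q)) = 0) :
    chooseOne.wp (fun τ => Keeps edgeRegs σ τ ∧ τ.reg 9 = σ.reg 9 - 1 ∧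
      τ.reg 13 = σ.reg 13 ∧ τ.mem = Function.update σ.mem (addr .ind (some q)) 1) σ := by
  simp [h.zero, h.one, h.parent, hq]

theorem wp_chooseOne_self (h : AtEdge σ p q c)
    (hq : q = none ∨ σ.mem (addr .ind q) = 1)
    (hp : σ.mem (addr .ind (some p)) = 0) :
    chooseOne.wp (fun τ => Keeps edgeRegs σ τ ∧ τ.reg 9 = σ.reg 9 - 1 ∧
      τ.reg 13 = σ.reg 13 ∧
      τ.mem = Function.update σ.mem (addr .ind (some p)) 1) σ := by
  rcases hq with rfl | hq
  · simp [h.zero, h.one, h.vertex, h.parent, h.child, hp]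
  · by_cases hn : q = none <;>
      simp [hn, h.zero, h.one, h.vertex, h.parent, h.child, hq, hp]

theorem wp_chooseOne_skip_sibling (h : AtEdge σ p q c)
    (hq : q = none ∨ σ.mem (addr .ind q) = 1)
    (hp : σ.mem (addr .ind (some p)) = 1)
    (hl : σ.mem (addr .head (some p)) = base (some x))
    (hx : σ.mem (addr .ind (some x)) = 1) :
    chooseOne.wp (fun τ => Keeps edgeRegs σ τ ∧ τ.reg 9 = σ.reg 9 ∧
      τ.reg 13 = σ.reg 13 ∧
      τ.mem = Function.update σ.mem (addr .head (some p)) (σ.mem (addr .next (some x)))) σ := by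
  rcases hq with rfl | hq
  · simp [h.zero, h.one, h.vertex, h.parent, h.child, hp, hl, hx]
  · by_cases hn : q = none <;>
      simp [hn, h.zero, h.one, h.vertex, h.parent, h.child, hq, hp, hl, hx]

theorem wp_chooseOne_sibling (h : AtEdge σ p q c)
    (hq : q = none ∨ σ.mem (addr .ind q) = 1)
    (hp : σ.mem (addr .ind (some p)) = 1)
    (hl : σ.mem (addr .head (some p)) = base (some x))
    (hx : σ.mem (addr .ind (some x)) = 0) :
    chooseOne.wp (fun τ => Keeps edgeRegs σ τ ∧ τ.reg 9 = σ.reg 9 - 1 ∧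
      τ.reg 13 = σ.reg 13 ∧
      τ.mem = Function.update (Function.update (Function.update σ.mem
        (addr .head (some p)) (σ.mem (addr .next (some x))))
        (addr .ind (some x)) 1) (addr .cnt (some p)) (σ.mem (addr .cnt (some p)) + 1)) σ := by
  rcases hq with rfl | hq
  · simp [h.zero, h.one, h.vertex, h.parent, h.child, hp, hl, hx]
  · by_cases hn : q = none <;>
      simp [hn, h.zero, h.one, h.vertex, h.parent, h.child, hq, hp, hl, hx]

theorem wp_chooseOne_skip_child (h : AtEdge σ p q c)
    (hq : q = none ∨ σ.mem (addr .ind q) = 1)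
    (hp : σ.mem (addr .ind (some p)) = 1)
    (hl : σ.mem (addr .head (some p)) = 0)
    (hl' : σ.mem (addr .head (some c)) = base (some x))
    (hx : σ.mem (addr .ind (some x)) = 1) :
    chooseOne.wp (fun τ => Keeps edgeRegs σ τ ∧ τ.reg 9 = σ.reg 9 ∧
      τ.reg 13 = σ.reg 13 ∧
      τ.mem = Function.update σ.mem (addr .head (some c)) (σ.mem (addr .next (some x)))) σ := by
  rcases hq with rfl | hq
  · simp [h.zero, h.one, h.vertex, h.parent, h.child, hp, hl, hl', hx]
  · by_cases hn : q = none <;>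
      simp [hn, h.zero, h.one, h.vertex, h.parent, h.child, hq, hp, hl, hl', hx]

theorem wp_chooseOne_child (h : AtEdge σ p q c)
    (hq : q = none ∨ σ.mem (addr .ind q) = 1)
    (hp : σ.mem (addr .ind (some p)) = 1)
    (hl : σ.mem (addr .head (some p)) = 0)
    (hl' : σ.mem (addr .head (some c)) = base (some x))
    (hx : σ.mem (addr .ind (some x)) = 0) :
    chooseOne.wp (fun τ => Keeps edgeRegs σ τ ∧ τ.reg 9 = σ.reg 9 - 1 ∧
      τ.reg 13 = σ.reg 13 ∧
      τ.mem = Function.update (Function.update (Function.update σ.mem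
        (addr .head (some c)) (σ.mem (addr .next (some x))))
        (addr .ind (some x)) 1) (addr .cnt (some c)) (σ.mem (addr .cnt (some c)) + 1)) σ := by
  rcases hq with rfl | hq
  · simp [h.zero, h.one, h.vertex, h.parent, h.child, hp, hl, hl', hx]
  · by_cases hn : q = none <;>
      simp [hn, h.zero, h.one, h.vertex, h.parent, h.child, hq, hp, hl, hl', hx]

theorem wp_chooseOne_fail (h : AtEdge σ p q c)
    (hq : q = none ∨ σ.mem (addr .ind q) = 1)
    (hp : σ.mem (addr .ind (some p)) = 1)
    (hl : σ.mem (addr .head (some p)) = 0) (hl' : σ.mem (addr .head (some c)) = 0) :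
    chooseOne.wp (fun τ => Keeps edgeRegs σ τ ∧ τ.reg 9 = 0 ∧
      τ.reg 13 = 1 ∧ τ.mem = σ.mem) σ := by
  rcases hq with rfl | hq
  · simp [h.zero, h.one, h.vertex, h.parent, h.child, hp, hl, hl']
  · by_cases hn : q = none <;>
      simp [hn, h.zero, h.one, h.vertex, h.parent, h.child, hq, hp, hl, hl']

end

/-! ### The data structures in memory -/

section

variable {n : ℕ}

/-- The pointer `a` and the `next` entries of memory represent a linked list of vertices. -/
def IsChain (m : ℕ → ℤ) : ℤ → List (Fin n) → Prop
  | a, [] => a = 0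
  | a, x :: l => a = base (some x) ∧ IsChain m (m (addr .next (some x))) l

theorem IsChain.congr {m m' : ℕ → ℤ} {a : ℤ} {l : List (Fin n)} (h : IsChain m a l)
    (hm : ∀ x ∈ l, m' (addr .next (some x)) = m (addr .next (some x))) : IsChain m' a l := by
  induction l generalizing a with
  | nil => exact h
  | cons x l ih =>
    refine ⟨h.1, ?_⟩
    rw [hm x (by simp)]
    exact ih h.2 fun y hy => hm y (by simp [hy])

variable {par : Fin n → Option (Fin n)} {F P D : Finset (Fin n)} {rem : Fin n → List (Fin n)}
  {m : ℕ → ℤ}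

/-- The memory records the set `D`, the number of its elements among the children in `F` of
every vertex, and for every vertex `v` the list `rem v` of children in `F` which have not been
considered; such children have been left out from the lists of vertices in `P` only. -/
structure Recorded (par : Fin n → Option (Fin n)) (F P D : Finset (Fin n))
    (rem : Fin n → List (Fin n)) (m : ℕ → ℤ) : Prop where
  ind : ∀ o, m (addr .ind o) = indicator D o
  cnt : ∀ v, m (addr .cnt (some v)) = (children par (some v) ∩ F ∩ D).card
  chain : ∀ v, IsChain m (m (addr .head (some v))) (rem v)
  nodup : ∀ v, (rem v).Nodup
  mem_rem : ∀ v, ∀ c ∈ rem v, c ∈ F ∧ par c = some v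
  removed : ∀ v c, c ∈ F → par c = some v → c ∉ rem v → c ∈ D ∧ v ∈ P

/-- Counters see only children in `F`, so none changes. Such an `x` is counted when it is removed
from the tree; in this way the parent of `x`, which may still be unknown to the program, is not
needed now. -/
theorem Recorded.insert_outside (h : Recorded par F P D rem m) {x : Fin n} (hF : x ∉ F) :
    Recorded par F P (insert x D) rem (Function.update m (addr .ind (some x)) 1) where
  ind o := by
    rw [Function.update_apply]
    cases o with
    | none => simpa using h.ind none
    | some y =>
      by_cases hy : y = x
      · simp [hy]
      · simpa [hy] using h.ind (some y)
  cnt v := by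
    rw [Function.update_of_ne (by simp), h.cnt v, Finset.inter_insert_of_notMem (by simp [hF])]
  chain v := by
    rw [Function.update_of_ne (by simp)]
    exact (h.chain v).congr fun y _ => by simp
  nodup := h.nodup
  mem_rem := h.mem_rem
  removed v c hc hv hr := by
    obtain ⟨h1, h2⟩ := h.removed v c hc hv hr
    exact ⟨Finset.mem_insert_of_mem h1, h2⟩

theorem Recorded.insert_inside (h : Recorded par F P D rem m) {x s : Fin n} (hF : x ∈ F)
    (hs : par x = some s) (hD : x ∉ D) :
    Recorded par F P (insert x D) rem
      (Function.update (Function.update m (addr .ind (some x)) 1) (addr .cnt (some s))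
        (m (addr .cnt (some s)) + 1)) where
  ind o := by
    rw [Function.update_of_ne (by simp), Function.update_apply]
    cases o with
    | none => simpa using h.ind none
    | some y =>
      by_cases hy : y = x
      · simp [hy]
      · simpa [hy] using h.ind (some y)
  cnt v := by
    rw [Function.update_apply]
    by_cases hv : v = s
    · subst hv
      rw [if_pos rfl, h.cnt, Finset.inter_insert_of_mem (by simp [hF, hs]),
        Finset.card_insert_of_notMem (by simp [hD])]
      push_cast
      rfl
    · rw [if_neg (by simpa using hv), Function.update_of_ne (by simp), h.cnt,
        Finset.inter_insert_of_notMem]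
      simp only [Finset.mem_inter, mem_children, hs, Option.some.injEq]
      exact fun e => hv e.1.symm
  chain v := by
    rw [Function.update_of_ne (by simp), Function.update_of_ne (by simp)]
    exact (h.chain v).congr fun y _ => by simp
  nodup := h.nodup
  mem_rem := h.mem_rem
  removed v c hc hv hr := by
    obtain ⟨h1, h2⟩ := h.removed v c hc hv hr
    exact ⟨Finset.mem_insert_of_mem h1, h2⟩

theorem Recorded.pop (h : Recorded par F P D rem m) {x s : Fin n} {l : List (Fin n)}
    (hs : s ∈ P) (hl : rem s = x :: l) (hD : x ∈ D) :
    Recorded par F P D (Function.update rem s l)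
      (Function.update m (addr .head (some s)) (m (addr .next (some x)))) where
  ind o := by
    rw [Function.update_of_ne (by simp), h.ind]
  cnt v := by
    rw [Function.update_of_ne (by simp), h.cnt]
  chain v := by
    refine IsChain.congr (m := m) ?_ fun y _ => by simp
    by_cases hv : v = s
    · subst hv
      have := h.chain v
      rw [hl] at this
      simpa using this.2
    · rw [Function.update_of_ne (by simpa using hv), Function.update_of_ne hv]
      exact h.chain v
  nodup v := by
    by_cases hv : v = s
    · subst hv
      have := h.nodup v
      rw [hl] at this
      simpa using (List.nodup_cons.1 this).2
    · rw [Function.update_of_ne hv]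
      exact h.nodup v
  mem_rem v c hc := by
    by_cases hv : v = s
    · subst hv
      rw [Function.update_self] at hc
      exact h.mem_rem v c (by simp [hl, hc])
    · rw [Function.update_of_ne hv] at hc
      exact h.mem_rem v c hc
  removed v c hc hpc hr := by
    by_cases hv : v = s
    · subst hv
      rw [Function.update_self] at hr
      by_cases hcx : c = x
      · exact ⟨hcx ▸ hD, hs⟩
      · exact h.removed v c hc hpc (by simp [hl, hcx, hr])
    · rw [Function.update_of_ne hv] at hr
      exact h.removed v c hc hpc hr

/-- Combines `Recorded.insert_inside` and `Recorded.pop`, with the memory updates commuted into the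
order in which the program makes them. -/
theorem Recorded.take (h : Recorded par F P D rem m) {x s : Fin n} {l : List (Fin n)}
    (hs : s ∈ P) (hl : rem s = x :: l) (hD : x ∉ D) :
    Recorded par F P (insert x D) (Function.update rem s l)
      (Function.update (Function.update (Function.update m (addr .head (some s))
        (m (addr .next (some x)))) (addr .ind (some x)) 1) (addr .cnt (some s))
          (m (addr .cnt (some s)) + 1)) := by
  obtain ⟨hF, hx⟩ := h.mem_rem s x (by simp [hl])
  have h' := (h.insert_inside hF hx hD).pop hs hl (Finset.mem_insert_self x D)
  rw [Function.update_of_ne (by simp), Function.update_of_ne (by simp),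
    Function.update_comm (a := addr .cnt (some s)) (by simp),
    Function.update_comm (a := addr .ind (some x)) (b := addr .head (some s)) (by simp)] at h'
  exact h'

theorem Recorded.head_eq_zero (h : Recorded par F P D rem m) {v : Fin n} (hv : rem v = []) :
    m (addr .head (some v)) = 0 := by
  have := h.chain v
  rwa [hv] at this

theorem Recorded.head_eq (h : Recorded par F P D rem m) {v x : Fin n} {l : List (Fin n)}
    (hv : rem v = x :: l) : m (addr .head (some v)) = base (some x) := by
  have := h.chain v
  rw [hv] at this
  exact this.1

/-! ### The potential of the greedy choices -/

/-- The number of choices and list operations that are possible before the children in `todo`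
of `p` have been dealt with. -/
def potential (D : Finset (Fin n)) (q : Option (Fin n)) (p : Fin n) (rem : Fin n → List (Fin n))
    (todo : List (Fin n)) : ℤ :=
  2 - indicator D q - indicator D (some p) + (rem p).length +
    (todo.map fun w => ((rem w).length : ℤ)).sum

theorem indicator_le_insert (D : Finset (Fin n)) (x : Fin n) (o : Option (Fin n)) :
    indicator D o ≤ indicator (insert x D) o := by
  cases o with
  | none => simp
  | some y =>
    by_cases hy : y ∈ D
    · simp [hy]
    · simp only [indicator_some, hy, if_false]
      split_ifs <;> simp

theorem potential_insert_le (D : Finset (Fin n)) (x : Fin n) (q : Option (Fin n)) (p : Fin n)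
    (rem : Fin n → List (Fin n)) (todo : List (Fin n)) :
    potential (insert x D) q p rem todo ≤ potential D q p rem todo := by
  have h1 := indicator_le_insert D x q
  have h2 := indicator_le_insert D x (some p)
  simp only [potential]
  omega

theorem potential_insert_lt {x p : Fin n} {q : Option (Fin n)} (hx : x ∉ D)
    (h : q = some x ∨ p = x) (rem : Fin n → List (Fin n)) (todo : List (Fin n)) :
    potential (insert x D) q p rem todo + 1 ≤ potential D q p rem todo := by
  have h1 := indicator_le_insert D x q
  have h2 := indicator_le_insert D x (some p)
  have h3 : indicator D (some x) = 0 := by simp [hx]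
  have h4 : indicator (insert x D) (some x) = 1 := by simp
  simp only [potential]
  rcases h with rfl | rfl <;> omega

theorem potential_update_self {x p : Fin n} {l : List (Fin n)} (hl : rem p = x :: l)
    (q : Option (Fin n)) {todo : List (Fin n)} (hp : p ∉ todo) :
    potential D q p (Function.update rem p l) todo + 1 = potential D q p rem todo := by
  have : (todo.map fun w => ((Function.update rem p l w).length : ℤ)) =
      todo.map fun w => ((rem w).length : ℤ) :=
    List.map_congr_left fun w hw => by
      rw [Function.update_of_ne (fun e : w = p => hp (e ▸ hw))]
  simp only [potential, this, Function.update_self, hl, List.length_cons]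
  push_cast
  ring

theorem potential_update_head {x p c : Fin n} {l : List (Fin n)} (hl : rem c = x :: l)
    (q : Option (Fin n)) {todo : List (Fin n)} (hc : c ∉ todo) (hp : p ≠ c) :
    potential D q p (Function.update rem c l) (c :: todo) + 1 =
      potential D q p rem (c :: todo) := by
  have : (todo.map fun w => ((Function.update rem c l w).length : ℤ)) =
      todo.map fun w => ((rem w).length : ℤ) :=
    List.map_congr_left fun w hw => by
      rw [Function.update_of_ne (fun e : w = c => hc (e ▸ hw))]
  simp only [potential, List.map_cons, List.sum_cons, this, Function.update_self, hl,
    List.length_cons, Function.update_of_ne hp]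
  push_cast
  ring

theorem potential_cons (D : Finset (Fin n)) (q : Option (Fin n)) (p c : Fin n)
    (rem : Fin n → List (Fin n)) (todo : List (Fin n)) :
    potential D q p rem todo ≤ potential D q p rem (c :: todo) := by
  simp [potential]

theorem potential_nonneg (D : Finset (Fin n)) (q : Option (Fin n)) (p : Fin n)
    (rem : Fin n → List (Fin n)) (todo : List (Fin n)) : 0 ≤ potential D q p rem todo := by
  have h : ∀ o, indicator D o ≤ 1 := fun o => by
    cases o with
    | none => simp
    | some y => simp only [indicator_some]; split_ifs <;> simp
  have h1 := h q
  have h2 := h (some p)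
  have h3 : 0 ≤ (todo.map fun w => ((rem w).length : ℤ)).sum :=
    List.sum_nonneg (by simp)
  simp only [potential]
  omega

/-! ### The loop over the greedy choices for one edge -/

/-- What the flag says about the set `D`, when the edges into `F`, and those between `p` and
the vertices in `W`, have been dealt with. -/
def Verdict (G : SimpleGraph (Fin n)) (par : Fin n → Option (Fin n)) (k : ℤ)
    (D F : Finset (Fin n)) (p : Fin n) (W : Set (Fin n)) (flag : ℤ) : Prop :=
  (flag = 0 ∧ Settled G par k D F ∧ Extendable G k D ∧ ∀ w ∈ W, k ≤ cover G D w p) ∨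
    (flag = 1 ∧ ¬ ∃ D', IsKVEDominating G k D')

theorem cover_insert {G : SimpleGraph (Fin n)} {x u v : Fin n} (hx : x ∉ D)
    (hN : x ∈ closedNbhd G u ∪ closedNbhd G v) :
    cover G (insert x D) u v = cover G D u v + 1 := by
  rw [cover, cover, Finset.coe_insert, Set.inter_insert_of_mem hN,
    Set.ncard_insert_of_notMem (fun h => hx (by simpa using h.2))
      (D.finite_toSet.subset Set.inter_subset_right)]

/-- The entries which do not change while an edge is processed. -/
def SameShape (n : ℕ) (m m' : ℕ → ℤ) : Prop :=
  ∀ (o : Option (Fin n)), m' (addr .deg o) = m (addr .deg o) ∧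
    m' (addr .sum o) = m (addr .sum o) ∧ m' (addr .next o) = m (addr .next o)

theorem SameShape.trans {m m' m'' : ℕ → ℤ} (h : SameShape n m m') (h' : SameShape n m' m'') :
    SameShape n m m'' := fun o =>
  ⟨(h' o).1.trans (h o).1, (h' o).2.1.trans (h o).2.1, (h' o).2.2.trans (h o).2.2⟩

theorem SameShape.refl (m : ℕ → ℤ) : SameShape n m m := fun _ => ⟨rfl, rfl, rfl⟩

variable {G : SimpleGraph (Fin n)} {r : Fin n} {depth : Fin n → ℕ} {k : ℤ}

/-- The situation when the edge between `p` and its child `c` is dealt with. -/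
structure ChoiceInv (G : SimpleGraph (Fin n)) (par : Fin n → Option (Fin n)) (k : ℤ)
    (F : Finset (Fin n)) (p c : Fin n) (W : Set (Fin n)) (σ₀ σ : State)
    (D : Finset (Fin n)) (rem : Fin n → List (Fin n)) : Prop where
  keeps : Keeps edgeRegs σ₀ σ
  shape : SameShape n σ₀.mem σ.mem
  recorded : Recorded par F (insert p F) D rem σ.mem
  verdict : Verdict G par k D F p W (σ.reg 13)
  need : σ.reg 9 = k - cover G D c p ∨ σ.reg 9 ≤ 0 ∧ σ.reg 13 = 1

theorem AtEdge.keeps {σ σ' : State} {p c : Fin n} {q : Option (Fin n)} (h : AtEdge σ p q c)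
    (h' : Keeps edgeRegs σ σ') : AtEdge σ' p q c :=
  ⟨(h'.1 1 (by simp)).trans h.1, (h'.1 2 (by simp)).trans h.2, (h'.1 6 (by simp)).trans h.3,
    (h'.1 7 (by simp)).trans h.4, (h'.1 8 (by simp)).trans h.5⟩

theorem ChoiceInv.take {F : Finset (Fin n)} {p c x : Fin n} {W : Set (Fin n)}
    {σ₀ σ τ : State} {rem' : Fin n → List (Fin n)} (h : ChoiceInv G par k F p c W σ₀ σ D rem)
    (hpos : 0 < σ.reg 9) (hx : x ∉ D) (hN : x ∈ closedNbhd G c ∪ closedNbhd G p)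
    (hext : Settled G par k D F → Extendable G k D → (cover G D c p : ℤ) < k →
      Extendable G k (insert x D))
    (hk : Keeps edgeRegs σ τ) (hs : SameShape n σ.mem τ.mem)
    (h9 : τ.reg 9 = σ.reg 9 - 1) (h13 : τ.reg 13 = σ.reg 13)
    (hrec : Recorded par F (insert p F) (insert x D) rem' τ.mem) :
    ChoiceInv G par k F p c W σ₀ τ (insert x D) rem' := by
  -- A positive need rules out the failure alternative, so the edge really is deficient.
  have hneed : σ.reg 9 = k - cover G D c p := by
    rcases h.need with h' | h'
    · exact h'
    · omega
  refine ⟨h.keeps.trans hk, h.shape.trans hs, hrec, ?_, ?_⟩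
  · rw [h13]
    rcases h.verdict with ⟨hf, h1, h2, h3⟩ | hf
    · have hsub := Finset.subset_insert x D
      exact Or.inl ⟨hf, h1.mono hsub, hext h1 h2 (by omega), fun w hw =>
        (h3 w hw).trans (by exact_mod_cast cover_mono hsub)⟩
    · exact Or.inr hf
  · left
    rw [h9, hneed, cover_insert hx hN]
    push_cast
    ring

theorem SameShape.update_ind {m : ℕ → ℤ} {o : Option (Fin n)} {z : ℤ} :
    SameShape n m (Function.update m (addr .ind o) z) := fun _ => by simp

theorem SameShape.update_head {m : ℕ → ℤ} {o : Option (Fin n)} {z : ℤ} :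
    SameShape n m (Function.update m (addr .head o) z) := fun _ => by simp

theorem SameShape.update_cnt {m : ℕ → ℤ} {o : Option (Fin n)} {z : ℤ} :
    SameShape n m (Function.update m (addr .cnt o) z) := fun _ => by simp

theorem ChoiceInv.pop {F : Finset (Fin n)} {p c : Fin n} {W : Set (Fin n)}
    {σ₀ σ τ : State} {rem' : Fin n → List (Fin n)} (h : ChoiceInv G par k F p c W σ₀ σ D rem)
    (hk : Keeps edgeRegs σ τ) (hs : SameShape n σ.mem τ.mem)
    (h9 : τ.reg 9 = σ.reg 9) (h13 : τ.reg 13 = σ.reg 13)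
    (hrec : Recorded par F (insert p F) D rem' τ.mem) :
    ChoiceInv G par k F p c W σ₀ τ D rem' :=
  ⟨h.keeps.trans hk, h.shape.trans hs, hrec, h13 ▸ h.verdict, by rw [h9, h13]; exact h.need⟩

/-- Every choice or list removal lowers the potential by at least one. The failing branch does not,
but it sets the need to zero, and the conditional term records this. -/
theorem chooseOne_spec (hr : IsRooting G r par depth) {p c : Fin n} {W : Set (Fin n)}
    (hclosed : ∀ a b, par a = some b → b ∈ F → a ∈ F) (hpF : p ∉ F)
    (hkids : ∀ a, par a = some p → a ∈ F) (hc : par c = some p) {todo : List (Fin n)}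
    (hctodo : c ∉ todo) (hptodo : p ∉ c :: todo) {σ₀ σ : State} (hat : AtEdge σ₀ p (par p) c)
    (h : ChoiceInv G par k F p c W σ₀ σ D rem) (hpos : 0 < σ.reg 9) :
    chooseOne.wp (fun τ => ∃ D' rem', ChoiceInv G par k F p c W σ₀ τ D' rem' ∧
      potential D' (par p) p rem' (c :: todo) + (if 0 < τ.reg 9 then 1 else 0) ≤
        potential D (par p) p rem (c :: todo)) σ := by
  have hat' := hat.keeps h.keeps
  have hrec := h.recorded
  have hite : ∀ z : ℤ, (if 0 < z then (1 : ℤ) else 0) ≤ 1 := fun z => by split_ifs <;> simp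
  have hpc : p ≠ c := fun e => hptodo (by simp [e])
  have hp1 : p ∈ insert p F := Finset.mem_insert_self _ _
  have hc1 : c ∈ insert p F := Finset.mem_insert_of_mem (hkids c hc)
  by_cases hq : ∃ q, par p = some q ∧ q ∉ D
  · obtain ⟨q, hpq, hqD⟩ := hq
    rw [hpq] at hat'
    refine Prog.wp_mono (wp_chooseOne_parent hat' (by simp [hrec.ind, hqD])) ?_
    rintro τ ⟨hk, h9, h13, hm⟩
    refine ⟨insert q D, rem, h.take hpos hqD ((hr.mem_nbhd hc).2 (by simp [hpq]))
      (fun hS hE hdef => hr.extendable_insert_parent hS hE hkids hc hdef hpq hqD) hk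
      (hm ▸ .update_ind) h9 h13 (hm ▸ hrec.insert_outside fun hF => hpF (hclosed _ _ hpq hF)), ?_⟩
    have := potential_insert_lt hqD (p := p) (Or.inl hpq) rem (c :: todo)
    have := hite (τ.reg 9)
    omega
  have hqD : ∀ q, par p = some q → q ∈ D := by
    intro q hpq
    by_contra hqD
    exact hq ⟨q, hpq, hqD⟩
  have hq1 : par p = none ∨ σ.mem (addr .ind (par p)) = 1 := by
    cases hpq : par p with
    | none => exact Or.inl rfl
    | some q => exact Or.inr (by simp [hrec.ind, hqD q hpq])
  by_cases hpD : p ∈ D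
  swap
  · refine Prog.wp_mono (wp_chooseOne_self hat' hq1 (by simp [hrec.ind, hpD])) ?_
    rintro τ ⟨hk, h9, h13, hm⟩
    refine ⟨insert p D, rem, h.take hpos hpD ((hr.mem_nbhd hc).2 (by simp))
      (fun hS hE hdef => hr.extendable_insert_self hS hE hkids hc hdef hqD hpD) hk
      (hm ▸ .update_ind) h9 h13 (hm ▸ hrec.insert_outside hpF), ?_⟩
    have := potential_insert_lt hpD (q := par p) (Or.inr rfl) rem (c :: todo)
    have := hite (τ.reg 9)
    omega
  have hp2 : σ.mem (addr .ind (some p)) = 1 := by simp [hrec.ind, hpD]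
  cases hl : rem p with
  | cons x l =>
    have hxp := (hrec.mem_rem p x (by simp [hl])).2
    have hpot := potential_update_self (D := D) hl (par p) hptodo
    by_cases hxD : x ∈ D
    · refine Prog.wp_mono (wp_chooseOne_skip_sibling hat' hq1 hp2 (hrec.head_eq hl)
        (by simp [hrec.ind, hxD])) ?_
      rintro τ ⟨hk, h9, h13, hm⟩
      refine ⟨D, Function.update rem p l, h.pop hk (hm ▸ .update_head) h9 h13
        (hm ▸ hrec.pop hp1 hl hxD), ?_⟩
      have := hite (τ.reg 9)
      omega
    · refine Prog.wp_mono (wp_chooseOne_sibling hat' hq1 hp2 (hrec.head_eq hl)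
        (by simp [hrec.ind, hxD])) ?_
      rintro τ ⟨hk, h9, h13, hm⟩
      refine ⟨insert x D, Function.update rem p l, h.take hpos hxD
        ((hr.mem_nbhd hc).2 (by simp [hxp]))
        (fun hS hE hdef => hr.extendable_insert_sibling hS hE hkids hc hdef hqD hpD hxp hxD) hk
        (hm ▸ (SameShape.update_head.trans .update_ind).trans .update_cnt) h9 h13
        (hm ▸ hrec.take hp1 hl hxD), ?_⟩
      have := potential_insert_le D x (par p) p (Function.update rem p l) (c :: todo)
      have := hite (τ.reg 9)
      omega
  | nil =>
    -- Children leave a list only when they are in `D`, so an empty list means that all of them are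
    -- chosen.
    have hcD : ∀ a, par a = some p → a ∈ D := fun a ha =>
      (hrec.removed p a (hkids a ha) ha (by simp [hl])).1
    have hl0 := hrec.head_eq_zero hl
    cases hl' : rem c with
    | cons x l =>
      have hxc := (hrec.mem_rem c x (by simp [hl'])).2
      have hpot := potential_update_head (D := D) hl' (par p) hctodo hpc
      by_cases hxD : x ∈ D
      · refine Prog.wp_mono (wp_chooseOne_skip_child hat' hq1 hp2 hl0 (hrec.head_eq hl')
          (by simp [hrec.ind, hxD])) ?_
        rintro τ ⟨hk, h9, h13, hm⟩
        refine ⟨D, Function.update rem c l, h.pop hk (hm ▸ .update_head) h9 h13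
        (hm ▸ hrec.pop hc1 hl' hxD), ?_⟩
        have := hite (τ.reg 9)
        omega
      · refine Prog.wp_mono (wp_chooseOne_child hat' hq1 hp2 hl0 (hrec.head_eq hl')
          (by simp [hrec.ind, hxD])) ?_
        rintro τ ⟨hk, h9, h13, hm⟩
        refine ⟨insert x D, Function.update rem c l, h.take hpos hxD
        ((hr.mem_nbhd hc).2 (by simp [hxc]))
          (fun hS hE hdef =>
            hr.extendable_insert_child hS hE hkids hc hdef hqD hpD hcD hxc hxD) hk
          (hm ▸ (SameShape.update_head.trans .update_ind).trans .update_cnt) h9 h13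
          (hm ▸ hrec.take hc1 hl' hxD), ?_⟩
        have := potential_insert_le D x (par p) p (Function.update rem c l) (c :: todo)
        have := hite (τ.reg 9)
        omega
    | nil =>
      have hvD : ∀ a, par a = some c → a ∈ D := fun a ha =>
        (hrec.removed c a (hclosed a c ha (hkids c hc)) ha (by simp [hl'])).1
      refine Prog.wp_mono (wp_chooseOne_fail hat' hq1 hp2 hl0 (hrec.head_eq_zero hl')) ?_
      rintro τ ⟨hk, h9, h13, hm⟩
      refine ⟨D, rem, ⟨h.keeps.trans hk, hm ▸ h.shape, hm ▸ hrec, Or.inr ⟨h13, ?_⟩,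
        Or.inr ⟨h9.le, h13⟩⟩, by simp [h9]⟩
      rcases h.need with hneed | hneed
      · exact hr.not_exists hc (by omega) hqD hpD hcD hvD
      · omega

end

/-! ### The subprograms that treat a vertex and remove it from the tree. -/

/-- Compute how many further elements the edge between the vertices in registers `8` and `6`
needs. -/
def computeNeed : Prog :=
  .seq (getField 10 8 .cnt) (.seq (.sub 9 3 10) (.seq (getField 10 6 .cnt) (.seq (.sub 9 9 10)
    (.seq (getField 10 6 .ind) (.seq (.sub 9 9 10) (.seq (getField 10 7 .ind) (.sub 9 9 10)))))))

/-- Deal with the edge between the vertices in registers `8` and `6`, and move register `8` on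
to the next child. -/
def dealWithChild : Prog :=
  .seq computeNeed (.seq (.while (.lt 1 9) chooseOne) (getField 8 8 .next))

/-- Deal with all edges between the vertex in register `6` and its children. -/
def dealWithChildren : Prog :=
  .seq (getField 8 6 .head) (.while (.lt 1 8) dealWithChild)

/-- Remove the vertex in register `6` from the tree, and add it to the list of children of its
parent, which is in register `7`. -/
def detach : Prog :=
  .seq (putField 6 .deg 1) (.seq (subField 7 .deg 2) (.seq (subField 7 .sum 6)
    (.seq (getField 10 7 .head) (.seq (putField 6 .next 10) (.seq (putField 7 .head 6)
      (.seq (getField 11 6 .ind) (addField 7 .cnt 11)))))))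

/-- Deal with the vertex in register `6`, which is a leaf, and move on to its parent. -/
def processLeaf : Prog :=
  .seq (getField 7 6 .sum) (.seq dealWithChildren (.seq detach
    (.seq (.copy 6 7) (getField 10 6 .deg))))

/-- Process leaves as long as the vertex in register `6` is a leaf. -/
def climb : Prog :=
  .seq (.copy 6 5) (.seq (getField 10 6 .deg) (.seq (.while (.eq 10 2) processLeaf)
    (.add 5 5 14)))

section

variable {n : ℕ} {σ : State} {p c x : Fin n} {q : Option (Fin n)}

attribute [local simp] State.setReg State.setMem Prog.wp Test.Holds Function.update_apply
  getField putField addField subField Keeps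

theorem wp_computeNeed (h : AtEdge σ p q c) :
    computeNeed.wp (fun τ => Keeps edgeRegs σ τ ∧ τ.reg 13 = σ.reg 13 ∧ τ.mem = σ.mem ∧
      τ.reg 9 = σ.reg 3 - (σ.mem (addr .cnt (some c)) + σ.mem (addr .cnt (some p)) +
        σ.mem (addr .ind (some p)) + σ.mem (addr .ind q))) σ := by
  simp [computeNeed, h.vertex, h.parent, h.child]
  ring

theorem wp_detach (h1 : σ.reg 1 = 0) (h2 : σ.reg 2 = 1) (h6 : σ.reg 6 = base (some p))
    (h7 : σ.reg 7 = base q) (hq : q ≠ some p) :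
    detach.wp (fun τ => Keeps edgeRegs σ τ ∧ τ.reg 13 = σ.reg 13 ∧
      τ.mem = Function.update (Function.update (Function.update (Function.update (Function.update
        (Function.update σ.mem (addr .deg (some p)) 0)
        (addr .deg q) (σ.mem (addr .deg q) - 1))
        (addr .sum q) (σ.mem (addr .sum q) - base (some p)))
        (addr .next (some p)) (σ.mem (addr .head q)))
        (addr .head q) (base (some p)))
        (addr .cnt q) (σ.mem (addr .cnt q) + σ.mem (addr .ind (some p)))) σ := by
  simp [detach, h1, h2, h6, h7, hq]

end

section

variable {n : ℕ} {par : Fin n → Option (Fin n)} {F P D : Finset (Fin n)}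
  {rem : Fin n → List (Fin n)} {m : ℕ → ℤ} {G : SimpleGraph (Fin n)} {r : Fin n}
  {depth : Fin n → ℕ} {k : ℤ}

/-- All children of `c` and of `p` lie in `F`, so their counters are complete. -/
theorem Recorded.cover_eq (h : Recorded par F P D rem m) (hr : IsRooting G r par depth)
    (hclosed : ∀ a b, par a = some b → b ∈ F → a ∈ F) {p c : Fin n}
    (hkids : ∀ a, par a = some p → a ∈ F) (hc : par c = some p) :
    (cover G D c p : ℤ) = m (addr .cnt (some c)) + m (addr .cnt (some p)) +
      m (addr .ind (some p)) + m (addr .ind (par p)) := by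
  have h1 : children par (some c) ∩ F = children par (some c) :=
    Finset.inter_eq_left.2 fun a ha => hclosed a c (mem_children.1 ha) (hkids c hc)
  have h2 : children par (some p) ∩ F = children par (some p) :=
    Finset.inter_eq_left.2 fun a ha => hkids a (mem_children.1 ha)
  rw [hr.cover_eq hc, h.cnt, h.cnt, h.ind, h.ind, h1, h2]

/-- An iteration costs at most `40`: a test and `39` steps of `chooseOne`. The `60` consists of `16`
for the need, `40` for one iteration that may not lower the potential, `1` for the final test and
`3` for the move to the next child. -/
theorem dealWithChild_spec (hr : IsRooting G r par depth) {p c : Fin n} {W : Set (Fin n)}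
    (hclosed : ∀ a b, par a = some b → b ∈ F → a ∈ F) (hpF : p ∉ F)
    (hkids : ∀ a, par a = some p → a ∈ F) (hc : par c = some p) {todo : List (Fin n)}
    (hctodo : c ∉ todo) (hptodo : p ∉ c :: todo) {σ : State} (hat : AtEdge σ p (par p) c)
    (h3 : σ.reg 3 = k) (hrec : Recorded par F (insert p F) D rem σ.mem)
    (hver : Verdict G par k D F p W (σ.reg 13)) {b : ℕ} {R : ℤ}
    (hb : 40 * potential D (par p) p rem (c :: todo) + 60 + R ≤ b) (hR : 0 ≤ R) :
    Runs dealWithChild σ b fun τ b' => ∃ D' rem',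
      Keeps [1, 2, 3, 4, 5, 6, 7, 14] σ τ ∧ SameShape n σ.mem τ.mem ∧
      Recorded par F (insert p F) D' rem' τ.mem ∧
      Verdict G par k D' F p (insert c W) (τ.reg 13) ∧
      τ.reg 8 = σ.mem (addr .next (some c)) ∧
      40 * potential D' (par p) p rem' todo + R ≤ b' := by
  have hnonneg := potential_nonneg D (par p) p rem (c :: todo)
  refine Runs.seq (Runs.of_wp (b' := b - 16) (Prog.wp_mono (wp_computeNeed hat) ?_)
    (by simp [computeNeed, getField, Prog.cost]; omega))
  rintro σ₁ ⟨hk, h13, hm, h9⟩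
  refine Runs.seq (Runs.loop (fun τ b => ∃ D' rem', ChoiceInv G par k F p c W σ₁ τ D' rem' ∧
    40 * (potential D' (par p) p rem' (c :: todo) + if 0 < τ.reg 9 then 1 else 0) + 4 + R ≤ b)
    ?_ ?_ ?_)
  · rintro τ b ⟨D', rem', hinv, hb⟩ hpos
    have h1 : τ.reg 1 = 0 := (hat.keeps (hk.trans hinv.keeps)).zero
    have hpos' : 0 < τ.reg 9 := by simpa [Test.Holds, h1] using hpos
    have := potential_nonneg D' (par p) p rem' (c :: todo)
    rw [if_pos hpos'] at hb
    refine ⟨b - 1, by omega, Runs.of_wp (b' := b - 40) (Prog.wp_mono (chooseOne_spec hr hclosed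
      hpF hkids hc hctodo hptodo (hat.keeps hk) hinv hpos') ?_) ?_⟩
    · rintro τ' ⟨D'', rem'', hinv', hpot⟩
      exact ⟨D'', rem'', hinv', by omega⟩
    · simp [chooseOne, popChild, getField, putField, addField, Prog.cost]
      omega
  · rintro τ b ⟨D', rem', hinv, hb⟩ hneg
    have hat' := hat.keeps (hk.trans hinv.keeps)
    have hneg' : τ.reg 9 ≤ 0 := by simpa [Test.Holds, hat'.zero] using hneg
    have := potential_nonneg D' (par p) p rem' (c :: todo)
    have := potential_cons D' (par p) p c rem' todo
    rw [if_neg (by omega)] at hb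
    refine ⟨b - 1, by omega, Runs.of_wp (b' := b - 4) ?_ (by simp [getField, Prog.cost]; omega)⟩
    simp only [getField, Prog.wp, State.setReg, Function.update_self, hat'.child,
      Function.update_of_ne (show (8 : ℕ) ≠ 0 by simp), base_add_offset_nonneg,
      toNat_base_add_offset, true_and]
    refine ⟨D', rem', (Keeps.subset (hk.trans hinv.keeps) (by simp)).trans ?_, ?_, hinv.recorded,
      ?_, ?_, by omega⟩
    · simp [Keeps, Function.update_apply]
    · exact hm ▸ hinv.shape
    · simp only [Function.update_of_ne (show (13 : ℕ) ≠ 8 by simp),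
        Function.update_of_ne (show (13 : ℕ) ≠ 0 by simp)]
      rcases hinv.verdict with ⟨hf, hS, hE, hW⟩ | hf
      · refine Or.inl ⟨hf, hS, hE, ?_⟩
        rintro w (rfl | hw)
        · rcases hinv.need with h | h <;> omega
        · exact hW w hw
      · exact Or.inr hf
    · rw [← hm]
      exact (hinv.shape (some c)).2.2
  · refine ⟨D, rem, ⟨Keeps.refl _ _, SameShape.refl _, hm ▸ hrec, h13 ▸ hver, Or.inl ?_⟩, ?_⟩
    · rw [h9, h3, hrec.cover_eq hr hclosed hkids hc]
    · have : (if 0 < σ₁.reg 9 then (1 : ℤ) else 0) ≤ 1 := by split_ifs <;> simp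
      omega

theorem Recorded.mono {P' : Finset (Fin n)} (h : Recorded par F P D rem m) (hP : P ⊆ P') :
    Recorded par F P' D rem m :=
  { h with removed := fun v c h1 h2 h3 => ⟨(h.removed v c h1 h2 h3).1,
      hP (h.removed v c h1 h2 h3).2⟩ }

theorem Verdict.subset {W W' : Set (Fin n)} {p : Fin n} {f : ℤ}
    (h : Verdict G par k D F p W f) (hW : W' ⊆ W) : Verdict G par k D F p W' f := by
  rcases h with ⟨hf, hS, hE, h⟩ | h
  · exact Or.inl ⟨hf, hS, hE, fun w hw => h w (hW hw)⟩
  · exact Or.inr h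

/-- The traversal follows the `next` entries, which stay fixed by `SameShape`. It is therefore
undisturbed when greedy choices advance the head of the very list being traversed; `todo` and `rem
p` evolve independently. -/
theorem dealWithChildren_spec (hr : IsRooting G r par depth) {p : Fin n}
    (hclosed : ∀ a b, par a = some b → b ∈ F → a ∈ F) (hpF : p ∉ F)
    (hkids : ∀ a, par a = some p → a ∈ F) {σ : State}
    (h1 : σ.reg 1 = 0) (h2 : σ.reg 2 = 1) (h3 : σ.reg 3 = k) (h6 : σ.reg 6 = base (some p))
    (h7 : σ.reg 7 = base (par p)) (hrec : Recorded par F F D rem σ.mem)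
    (hver : Verdict G par k D F p ∅ (σ.reg 13)) {b : ℕ} {R : ℤ}
    (hb : 40 * potential D (par p) p rem (rem p) + 61 * (rem p).length + 4 + R ≤ b)
    (hR : 0 ≤ R) :
    Runs dealWithChildren σ b fun τ b' => ∃ D' rem',
      Keeps [1, 2, 3, 4, 5, 6, 7, 14] σ τ ∧ SameShape n σ.mem τ.mem ∧
      Recorded par F (insert p F) D' rem' τ.mem ∧
      Verdict G par k D' F p {w | par w = some p} (τ.reg 13) ∧ R ≤ b' := by
  have hnonneg := potential_nonneg D (par p) p rem (rem p)
  refine Runs.seq (Runs.of_wp (b' := b - 3) ?_ (by simp [getField, Prog.cost]; omega))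
  simp only [getField, Prog.wp, State.setReg, Function.update_self, h6,
      Function.update_of_ne (show (6 : ℕ) ≠ 0 by simp), base_add_offset_nonneg,
      toNat_base_add_offset, true_and]
  refine Runs.loop (fun τ b => ∃ D' rem' todo, Keeps [1, 2, 3, 4, 5, 6, 7, 14] σ τ ∧
    SameShape n σ.mem τ.mem ∧ Recorded par F (insert p F) D' rem' τ.mem ∧
    Verdict G par k D' F p {w | par w = some p ∧ w ∉ todo} (τ.reg 13) ∧
    IsChain τ.mem (τ.reg 8) todo ∧ todo.Nodup ∧ (∀ w ∈ todo, par w = some p) ∧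
    40 * potential D' (par p) p rem' todo + 61 * todo.length + 1 + R ≤ b) ?_ ?_ ?_
  · rintro τ b ⟨D', rem', todo, hk, hs, hrec', hver', hch, hnd, hpar, hb⟩ hpos
    have e1 : τ.reg 1 = 0 := (hk.1 1 (by simp)).trans h1
    cases todo with
    | nil => simp [Test.Holds, e1, show τ.reg 8 = 0 from hch] at hpos
    | cons c todo =>
      have hpc := potential_nonneg D' (par p) p rem' (c :: todo)
      rw [List.length_cons] at hb
      push_cast at hb
      have hc : par c = some p := hpar c (by simp)
      have hctodo : c ∉ todo := (List.nodup_cons.1 hnd).1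
      have hptodo : p ∉ c :: todo := fun h => hpF (hkids p (hpar p h))
      have hat : AtEdge τ p (par p) c := ⟨e1, (hk.1 2 (by simp)).trans h2,
        (hk.1 6 (by simp)).trans h6, (hk.1 7 (by simp)).trans h7, hch.1⟩
      refine ⟨b - 1, by omega, (dealWithChild_spec hr hclosed hpF hkids hc hctodo hptodo hat
        ((hk.1 3 (by simp)).trans h3) hrec' hver' (R := 61 * todo.length + 1 + R)
        (by omega) (by omega)).mono le_rfl ?_⟩
      rintro τ' b' ⟨D'', rem'', hk', hs', hrec'', hver'', h8, hb'⟩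
      refine ⟨D'', rem'', todo, hk.trans hk', hs.trans hs', hrec'', hver''.subset ?_, ?_,
        (List.nodup_cons.1 hnd).2, fun w hw => hpar w (by simp [hw]), by omega⟩
      · rintro w ⟨hw, hwt⟩
        by_cases hwc : w = c
        · exact Or.inl hwc
        · exact Or.inr ⟨hw, by simp [hwc, hwt]⟩
      · rw [h8]
        exact hch.2.congr fun x _ => (hs' (some x)).2.2
  · rintro τ b ⟨D', rem', todo, hk, hs, hrec', hver', hch, hnd, hpar, hb⟩ hneg
    have e1 : τ.reg 1 = 0 := (hk.1 1 (by simp)).trans h1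
    have hpc := potential_nonneg D' (par p) p rem' todo
    cases todo with
    | nil =>
      refine ⟨b - 1, by simp at hb; omega, D', rem', hk, hs, hrec', hver'.subset ?_, ?_⟩
      · intro w hw
        exact ⟨hw, by simp⟩
      · simp at hb; omega
    | cons c todo => simp [Test.Holds, e1, hch.1] at hneg
  · refine ⟨D, rem, rem p, by simp [Keeps], SameShape.refl _,
      hrec.mono (Finset.subset_insert _ _), ?_, ?_, hrec.nodup p,
      fun w hw => (hrec.mem_rem p w hw).2, ?_⟩
    -- As `p ∉ F`, its list is still complete at the start, so every child is on the list to be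
    -- traversed.
    · refine Verdict.subset (W := ∅) (by simpa using hver) ?_
      rintro w ⟨hw, hwr⟩
      exact hpF (hrec.removed p w (hkids w hw) hw hwr).2
    · simpa using hrec.chain p
    · omega

end

/-! ### Pruning leaves -/

section

variable {n : ℕ} {par : Fin n → Option (Fin n)} {F P D : Finset (Fin n)}
  {rem : Fin n → List (Fin n)} {m : ℕ → ℤ} {G : SimpleGraph (Fin n)} {r : Fin n}
  {depth : Fin n → ℕ} {k : ℤ} {p : Fin n}

/-- The memory records the degrees in the tree that remains after the removal of `F`, and the
sums of the neighbours there. A parent, possibly missing, is counted for every vertex. -/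
structure Pruned (par : Fin n → Option (Fin n)) (F : Finset (Fin n)) (m : ℕ → ℤ) : Prop where
  closed : ∀ a b, par a = some b → b ∈ F → a ∈ F
  deg : ∀ v ∉ F, m (addr .deg (some v)) = (children par (some v) \ F).card + 1
  deg_done : ∀ v ∈ F, m (addr .deg (some v)) = 0
  deg_none : m (addr .deg (none : Option (Fin n))) ≤ 0
  sum : ∀ v ∉ F, m (addr .sum (some v)) =
    ∑ c ∈ children par (some v) \ F, (base (some c) : ℤ) + base (par v)

theorem Pruned.congr {m' : ℕ → ℤ} (h : Pruned par F m) (hs : SameShape n m m') :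
    Pruned par F m' where
  closed := h.closed
  deg v hv := (hs _).1.trans (h.deg v hv)
  deg_done v hv := (hs _).1.trans (h.deg_done v hv)
  deg_none := (hs _).1.trans_le h.deg_none
  sum v hv := (hs _).2.1.trans (h.sum v hv)

/-- The degree includes the possibly missing parent, so degree one leaves no child outside `F`, and
the sum of neighbours reduces to the address of the parent. -/
theorem Pruned.leaf (h : Pruned par F m) (hp : m (addr .deg (some p)) = 1) :
    p ∉ F ∧ (∀ a, par a = some p → a ∈ F) ∧ m (addr .sum (some p)) = base (par p) := by
  have hpF : p ∉ F := fun hF => by simp [h.deg_done p hF] at hp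
  have he : children par (some p) \ F = ∅ := by
    have := h.deg p hpF
    rw [hp] at this
    exact Finset.card_eq_zero.1 (by omega)
  refine ⟨hpF, fun a ha => ?_, by simp [h.sum p hpF, he]⟩
  by_contra haF
  have : a ∈ children par (some p) \ F := by simp [ha, haF]
  simp [he] at this

/-- The memory after `p` has been removed from the tree. -/
def detachMem (m : ℕ → ℤ) (p : Fin n) (q : Option (Fin n)) : ℕ → ℤ :=
  Function.update (Function.update (Function.update (Function.update (Function.update
    (Function.update m (addr .deg (some p)) 0)
    (addr .deg q) (m (addr .deg q) - 1))
    (addr .sum q) (m (addr .sum q) - base (some p)))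
    (addr .next (some p)) (m (addr .head q)))
    (addr .head q) (base (some p)))
    (addr .cnt q) (m (addr .cnt q) + m (addr .ind (some p)))

theorem Pruned.detach (h : Pruned par F m) (hp : m (addr .deg (some p)) = 1)
    (hpp : par p ≠ some p) : Pruned par (insert p F) (detachMem m p (par p)) := by
  obtain ⟨hpF, hkids, -⟩ := h.leaf hp
  have hqF : ∀ q, par p = some q → q ∉ F := fun q hq hqF => hpF (h.closed p q hq hqF)
  refine ⟨?_, ?_, ?_, ?_, ?_⟩
  · intro a b hab hb
    rcases Finset.mem_insert.1 hb with rfl | hb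
    · exact Finset.mem_insert_of_mem (hkids a hab)
    · exact Finset.mem_insert_of_mem (h.closed a b hab hb)
  · intro v hv
    simp only [Finset.mem_insert, not_or] at hv
    rw [Finset.sdiff_insert]
    by_cases hvq : par p = some v
    · have hmem : p ∈ children par (some v) \ F := by simp [hvq, hpF]
      have hpos := Finset.card_pos.2 ⟨p, hmem⟩
      rw [Finset.card_erase_of_mem hmem]
      simp [detachMem, hvq, h.deg v hv.2]
      omega
    · rw [Finset.erase_eq_of_notMem (by simp [hvq])]
      simp [detachMem, h.deg v hv.2, hv.1, Ne.symm hvq]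
  · intro v hv
    rcases Finset.mem_insert.1 hv with rfl | hv
    · simp [detachMem, Ne.symm hpp]
    · have : some v ≠ par p := fun e => hqF v e.symm hv
      simp [detachMem, Function.update_apply, h.deg_done v hv, this]
  -- Removing the root decrements the degree of the missing vertex, which thus stays nonpositive and
  -- never looks like a leaf.
  · have := h.deg_none
    simp only [detachMem, Function.update_apply, addr_inj, reduceCtorEq, and_false, if_false,
      false_and, true_and]
    split_ifs with hn
    · rw [← hn]; omega
    · exact this
  · intro v hv
    simp only [Finset.mem_insert, not_or] at hv
    rw [Finset.sdiff_insert]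
    by_cases hvq : par p = some v
    · have hmem : p ∈ children par (some v) \ F := by simp [hvq, hpF]
      rw [Finset.sum_erase_eq_sub hmem]
      simp [detachMem, hvq, h.sum v hv.2]
      ring
    · rw [Finset.erase_eq_of_notMem (by simp [hvq])]
      simp [detachMem, h.sum v hv.2, Ne.symm hvq]

/-- The lists of children after `p` has been removed from the tree. -/
def detachLists (rem : Fin n → List (Fin n)) (p : Fin n) (q : Option (Fin n)) :
    Fin n → List (Fin n) :=
  fun v => if q = some v then p :: rem v else rem v

/-- Since `p` now enters `F`, the counter of its parent must take it into account; adding the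
indicator of `p` does so, whenever `p` was chosen. The list receives `p` even if `p ∈ D`; such an
entry is skipped when it is popped. -/
theorem Recorded.detach (h : Recorded par F (insert p F) D rem m) (hpF : p ∉ F)
    (hqF : ∀ q, par p = some q → q ∉ F) (hpp : par p ≠ some p) :
    Recorded par (insert p F) (insert p F) D (detachLists rem p (par p))
      (detachMem m p (par p)) where
  ind o := by simpa [detachMem, Function.update_apply] using h.ind o
  cnt v := by
    by_cases hv : par p = some v
    · rw [Finset.inter_insert_of_mem (by simpa using hv)]
      by_cases hD : p ∈ D
      · rw [Finset.insert_inter_of_mem hD, Finset.card_insert_of_notMem (by simp [hpF])]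
        simp [detachMem, hv, h.cnt, h.ind, hD]
      · rw [Finset.insert_inter_of_notMem hD]
        simp [detachMem, hv, h.cnt, h.ind, hD]
    · rw [Finset.inter_insert_of_notMem (by simpa using hv)]
      simp [detachMem, Ne.symm hv, h.cnt]
  chain v := by
    have hch : ∀ a, IsChain m a (rem v) → IsChain (detachMem m p (par p)) a (rem v) := by
      intro a ha
      refine ha.congr fun x hx => ?_
      have : x ≠ p := fun e => hpF (e ▸ (h.mem_rem v x hx).1)
      simp [detachMem, this]
    by_cases hv : par p = some v
    · simp only [detachLists, hv, if_true, IsChain]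
      refine ⟨by simp [detachMem], ?_⟩
      have := hch _ (h.chain v)
      rw [hv] at this
      simpa [detachMem, Function.update_apply] using this
    · simp only [detachLists, hv, if_false]
      have := hch _ (h.chain v)
      simpa [detachMem, Function.update_apply, Ne.symm hv] using this
  nodup v := by
    simp only [detachLists]
    split_ifs
    · exact List.nodup_cons.2 ⟨fun e => hpF (h.mem_rem v p e).1, h.nodup v⟩
    · exact h.nodup v
  mem_rem v c hc := by
    simp only [detachLists] at hc
    split_ifs at hc with hv
    · rcases List.mem_cons.1 hc with rfl | hc
      · exact ⟨Finset.mem_insert_self _ _, hv⟩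
      · exact ⟨Finset.mem_insert_of_mem (h.mem_rem v c hc).1, (h.mem_rem v c hc).2⟩
    · exact ⟨Finset.mem_insert_of_mem (h.mem_rem v c hc).1, (h.mem_rem v c hc).2⟩
  removed v c hc hv hr := by
    rcases Finset.mem_insert.1 hc with rfl | hc
    · simp [detachLists, hv] at hr
    · refine h.removed v c hc hv fun hcr => hr ?_
      simp only [detachLists]
      split_ifs <;> simp [hcr]

/-! ### The linear bound on the total work. -/

/-- A bound for the number of steps that deal with a vertex. -/
def weight (par : Fin n → Option (Fin n)) (p : Fin n) : ℕ :=
  -- Here `128 = 40 * 2 + 48` and `101 = 40 + 61`: a unit of potential costs `40`, a child costs a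
  -- further `61`, and `48` is the fixed overhead.
  128 + 101 * (children par (some p)).card +
    40 * ∑ c ∈ children par (some p), (children par (some c)).card

theorem Recorded.length_le (h : Recorded par F P D rem m) (v : Fin n) :
    (rem v).length ≤ (children par (some v)).card := by
  rw [← List.toFinset_card_of_nodup (h.nodup v)]
  exact Finset.card_le_card fun c hc =>
    mem_children.2 (h.mem_rem v c (List.mem_toFinset.1 hc)).2

theorem Recorded.potential_le (h : Recorded par F P D rem m) (p : Fin n) (q : Option (Fin n)) :
    40 * potential D q p rem (rem p) + 61 * (rem p).length + 48 ≤ (weight par p : ℤ) := by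
  have hi : ∀ o, 0 ≤ indicator D o := fun o => by
    cases o with
    | none => simp
    | some y => simp only [indicator_some]; split_ifs <;> simp
  have h1 := h.length_le p
  have h2 : ((rem p).map fun w => ((rem w).length : ℤ)).sum ≤
      ∑ c ∈ children par (some p), ((children par (some c)).card : ℤ) := by
    rw [← List.sum_toFinset _ (h.nodup p)]
    refine (Finset.sum_le_sum fun c _ => ?_).trans
      (Finset.sum_le_sum_of_subset_of_nonneg (fun c hc =>
        mem_children.2 (h.mem_rem p c (List.mem_toFinset.1 hc)).2) fun _ _ _ => by positivity)
    exact_mod_cast h.length_le c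
  have h3 := hi q
  have h4 := hi (some p)
  simp only [potential, weight]
  push_cast
  omega

/-- Each vertex has at most one parent and one grandparent, so the numbers of children, and likewise
of grandchildren, add up to at most `n`; and `269 = 128 + 101 + 40`. -/
theorem sum_weight_le (par : Fin n → Option (Fin n)) : ∑ v, weight par v ≤ 269 * n := by
  have h1 : ∀ f : Fin n → ℕ, ∑ v, ∑ c ∈ children par (some v), f c ≤ ∑ c, f c := by
    intro f
    rw [← Finset.sum_biUnion]
    · exact Finset.sum_le_sum_of_subset (Finset.subset_univ _)
    · intro u _ v _ huv
      refine Finset.disjoint_left.2 fun c hu hv => huv ?_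
      have := (mem_children.1 hu).symm.trans (mem_children.1 hv)
      simpa using this
  have h2 : ∑ v, (children par (some v)).card ≤ n := by simpa using h1 fun _ => 1
  have h3 := h1 fun c => (children par (some c)).card
  simp only [weight, Finset.sum_add_distrib, ← Finset.mul_sum, Finset.sum_const,
    Finset.card_univ, Fintype.card_fin, smul_eq_mul]
  omega

/-! ### Correctness of the bottom-up traversal. -/

/-- The situation after the vertices in `F` have been dealt with. -/
structure Progress (G : SimpleGraph (Fin n)) (par : Fin n → Option (Fin n)) (k : ℤ)
    (F D : Finset (Fin n)) (rem : Fin n → List (Fin n)) (σ : State) : Prop where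
  zero : σ.reg 1 = 0
  one : σ.reg 2 = 1
  demand : σ.reg 3 = k
  eight : σ.reg 14 = 8
  pruned : Pruned par F σ.mem
  recorded : Recorded par F F D rem σ.mem
  verdict : (σ.reg 13 = 0 ∧ Settled G par k D F ∧ Extendable G k D) ∨
    (σ.reg 13 = 1 ∧ ¬ ∃ D', IsKVEDominating G k D')

/-- Among actual vertices, only `p` and its parent change degree, and that of `p` becomes zero; so
no vertex but the parent can turn into a leaf. The unit in `b + 1` pays for the loop test in
`climb`. -/
theorem processLeaf_spec (hr : IsRooting G r par depth) {σ : State}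
    (h : Progress G par k F D rem σ) (h6 : σ.reg 6 = base (some p))
    (hp : σ.mem (addr .deg (some p)) = 1) {b R : ℕ} (hb : weight par p + R ≤ b + 1) :
    Runs processLeaf σ b fun τ b' => ∃ D' rem', Progress G par k (insert p F) D' rem' τ ∧
      Keeps [4, 5] σ τ ∧ τ.reg 6 = base (par p) ∧ τ.reg 10 = τ.mem (addr .deg (par p)) ∧
      (∀ j, par p ≠ some j → σ.mem (addr .deg (some j)) ≠ 1 ∨ j = p →
        τ.mem (addr .deg (some j)) ≠ 1) ∧ R ≤ b' := by
  obtain ⟨hpF, hkids, hsum⟩ := h.pruned.leaf hp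
  have hclosed := h.pruned.closed
  have hqF : ∀ q, par p = some q → q ∉ F := fun q hq hqF => hpF (hclosed p q hq hqF)
  have hpp : par p ≠ some p := fun e => by
    have := hr.depth_eq p p e
    omega
  have hw := h.recorded.potential_le p (par p)
  have hnonneg := potential_nonneg D (par p) p rem (rem p)
  refine Runs.seq (Runs.of_wp (b' := b - 3) ?_ (by simp [getField, Prog.cost]; omega))
  simp only [getField, Prog.wp, State.setReg, Function.update_self, h6,
    Function.update_of_ne (show (6 : ℕ) ≠ 0 by simp), base_add_offset_nonneg,
    toNat_base_add_offset, true_and, hsum]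
  -- The reserved `40` pays for `detach` (`36` steps) and the move to the parent (`4` steps).
  refine Runs.seq ((dealWithChildren_spec hr hclosed hpF hkids (k := k) (D := D) (rem := rem)
    (R := (40 + R : ℕ)) (by simp [h.zero]) (by simp [h.one]) (by simp [h.demand])
    (by simp [h6]) (by simp) (by simpa using h.recorded) ?_ (by push_cast; omega)
    (by positivity)).mono le_rfl ?_)
  · rcases h.verdict with ⟨hf, hS, hE⟩ | hf
    · exact Or.inl ⟨by simpa using hf, hS, hE, by simp⟩
    · exact Or.inr (by simpa using hf)
  rintro σ₁ b₁ ⟨D', rem', hk, hs, hrec, hver, hb₁⟩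
  replace hs : SameShape n σ.mem σ₁.mem := hs
  have k1 : σ₁.reg 1 = 0 := by rw [hk.1 1 (by simp)]; simp [h.zero]
  have k2 : σ₁.reg 2 = 1 := by rw [hk.1 2 (by simp)]; simp [h.one]
  have k3 : σ₁.reg 3 = k := by rw [hk.1 3 (by simp)]; simp [h.demand]
  have k4 : σ₁.reg 4 = σ.reg 4 := by rw [hk.1 4 (by simp)]; simp
  have k5 : σ₁.reg 5 = σ.reg 5 := by rw [hk.1 5 (by simp)]; simp
  have k14 : σ₁.reg 14 = 8 := by rw [hk.1 14 (by simp)]; simp [h.eight]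
  have k6 : σ₁.reg 6 = base (some p) := by rw [hk.1 6 (by simp)]; simp [h6]
  have k7 : σ₁.reg 7 = base (par p) := by rw [hk.1 7 (by simp)]; simp
  refine Runs.seq (Runs.of_wp (b' := b₁ - 36) (Prog.wp_mono (wp_detach k1 k2 k6 k7 hpp) ?_)
    (by simp [detach, getField, putField, addField, subField, Prog.cost]; omega))
  rintro σ₂ ⟨hk₂, h13, hm⟩
  replace hm : σ₂.mem = detachMem σ₁.mem p (par p) := hm
  have j7 : σ₂.reg 7 = base (par p) := (hk₂.1 7 (by simp)).trans k7
  have hpr : Pruned par (insert p F) σ₂.mem :=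
    hm ▸ (h.pruned.congr hs).detach ((hs _).1.trans hp) hpp
  refine Runs.of_wp (b' := b₁ - 40) ?_ (by simp [Prog.cost]; omega)
  simp only [Prog.wp, State.setReg, Function.update_self, j7,
    Function.update_of_ne (show (6 : ℕ) ≠ 0 by simp), base_add_offset_nonneg,
    toNat_base_add_offset, true_and]
  refine ⟨D', detachLists rem' p (par p), ⟨?_, ?_, ?_, ?_, hpr, ?_, ?_⟩, ⟨?_, ?_, ?_⟩, ?_, ?_,
    by omega⟩
  · simpa using (hk₂.1 1 (by simp)).trans k1
  · simpa using (hk₂.1 2 (by simp)).trans k2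
  · simpa using (hk₂.1 3 (by simp)).trans k3
  · simpa using (hk₂.1 14 (by simp)).trans k14
  · exact hm ▸ hrec.detach hpF hqF hpp
  · simp only [Function.update_of_ne (show (13 : ℕ) ≠ 10 by simp),
      Function.update_of_ne (show (13 : ℕ) ≠ 0 by simp),
      Function.update_of_ne (show (13 : ℕ) ≠ 6 by simp), h13]
    rcases hver with ⟨hf, hS, hE, hW⟩ | hf
    · refine Or.inl ⟨hf, ⟨hpr.closed, fun a b' hab hb' => ?_⟩, hE⟩
      rcases Finset.mem_insert.1 hb' with rfl | hb'
      · exact hW a hab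
      · exact hS.dominated a b' hab hb'
    · exact Or.inr hf
  · have e4 := (hk₂.1 4 (by simp)).trans k4
    have e5 := (hk₂.1 5 (by simp)).trans k5
    simp [e4, e5]
  · exact hk₂.2.1.trans hk.2.1
  · exact hk₂.2.2.trans hk.2.2
  · simp
  · intro j hj hor
    rw [hm]
    by_cases hjp : j = p
    · subst hjp
      simp [detachMem, Ne.symm hj]
    · simpa [detachMem, Function.update_apply, Ne.symm hj, hjp, (hs (some j)).1] using hor

/-- The only vertex that can become a leaf is the parent at which the climb continues, so the scan
never has to return to smaller vertices. The work is charged to the removed vertices: the budget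
carries the total weight of the complement of `F`. -/
theorem climb_spec (hr : IsRooting G r par depth) {σ : State} {i : Fin n}
    (h : Progress G par k F D rem σ) (h5 : σ.reg 5 = base (some i))
    (hdeg : ∀ j < i, σ.mem (addr .deg (some j)) ≠ 1) {b R : ℕ}
    (hb : ∑ v ∈ Fᶜ, weight par v + 6 + R ≤ b) :
    Runs climb σ b fun τ b' => ∃ F' D' rem', Progress G par k F' D' rem' τ ∧
      Keeps [4] σ τ ∧ τ.reg 5 = σ.reg 5 + 8 ∧
      (∀ j ≤ i, τ.mem (addr .deg (some j)) ≠ 1) ∧ ∑ v ∈ F'ᶜ, weight par v + R ≤ b' := by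
  refine Runs.seq (Runs.of_wp (b' := b - 1) ?_ (by simp [Prog.cost]; omega))
  refine Runs.seq (Runs.of_wp (b' := b - 4) ?_ (by simp [getField, Prog.cost]; omega))
  simp only [getField, Prog.wp, State.setReg, Function.update_self, h5,
    Function.update_of_ne (show (6 : ℕ) ≠ 0 by simp), base_add_offset_nonneg,
    toNat_base_add_offset, true_and]
  refine Runs.seq (Runs.loop (fun τ b => ∃ F' D' rem' o, Progress G par k F' D' rem' τ ∧
    Keeps [4, 5] σ τ ∧ τ.reg 6 = base o ∧ τ.reg 10 = τ.mem (addr .deg o) ∧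
    (∀ j ≤ i, o ≠ some j → τ.mem (addr .deg (some j)) ≠ 1) ∧
    ∑ v ∈ F'ᶜ, weight par v + 2 + R ≤ b) ?_ ?_ ?_)
  · rintro τ b ⟨F', D', rem', o, hP, hk, h6, h10, hd, hb⟩ hone
    have hone : τ.reg 10 = 1 := by simpa [Test.Holds, hP.one] using hone
    rw [h10] at hone
    cases o with
    -- The climb ends above the root, because the missing vertex never has degree one.
    | none =>
      have := hP.pruned.deg_none
      omega
    | some p =>
      have hpF := (hP.pruned.leaf hone).1
      have hsum : ∑ v ∈ F'ᶜ, weight par v =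
          ∑ v ∈ (insert p F')ᶜ, weight par v + weight par p := by
        rw [Finset.compl_insert, Finset.sum_erase_add _ _ (by simpa using hpF)]
      refine ⟨b - 1, by omega, (processLeaf_spec hr hP h6 hone
        (R := ∑ v ∈ (insert p F')ᶜ, weight par v + 2 + R) (by omega)).mono le_rfl ?_⟩
      rintro τ' b' ⟨D'', rem'', hP', hk', h6', h10', hd', hb'⟩
      refine ⟨insert p F', D'', rem'', par p, hP', hk.trans hk', h6', h10', ?_, hb'⟩
      intro j hj hpj
      refine hd' j hpj ?_
      by_cases hjp : j = p
      · exact Or.inr hjp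
      · exact Or.inl (hd j hj (by simpa using Ne.symm hjp))
  · rintro τ b ⟨F', D', rem', o, hP, hk, h6, h10, hd, hb⟩ hone
    have hone : τ.reg 10 ≠ 1 := by simpa [Test.Holds, hP.one] using hone
    refine ⟨b - 1, by omega, Runs.of_wp (b' := b - 2) ?_ (by simp [Prog.cost]; omega)⟩
    refine ⟨F', D', rem', ⟨by simpa [State.setReg] using hP.zero,
      by simpa [State.setReg] using hP.one, by simpa [State.setReg] using hP.demand,
      by simpa [State.setReg] using hP.eight, hP.pruned, hP.recorded,
      by simpa [State.setReg] using hP.verdict⟩,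
      ⟨by simpa [State.setReg] using hk.1 4 (by simp), hk.2⟩, ?_, ?_, by omega⟩
    · have := hk.1 5 (by simp)
      simp [State.setReg, hP.eight, this, h5]
    · intro j hj
      by_cases hjo : o = some j
      · rw [h10, hjo] at hone
        exact hone
      · exact hd j hj hjo
  · refine ⟨F, D, rem, some i, ⟨by simpa using h.zero, by simpa using h.one,
      by simpa using h.demand, by simpa using h.eight, h.pruned, h.recorded,
      by simpa using h.verdict⟩, by simp [Keeps], by simp, by simp, ?_, by omega⟩
    intro j hj hij
    exact hdeg j (lt_of_le_of_ne hj fun e => hij (by rw [e]))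

/-- A deepest remaining vertex has no remaining child, hence would have degree one. -/
theorem Pruned.eq_univ (hr : IsRooting G r par depth) (h : Pruned par F m)
    (hdeg : ∀ j : Fin n, m (addr .deg (some j)) ≠ 1) : F = Finset.univ := by
  by_contra hF
  have hne : Fᶜ.Nonempty := Finset.nonempty_iff_ne_empty.2 (by simpa using hF)
  obtain ⟨v, hv, hmax⟩ := Finset.exists_max_image Fᶜ depth hne
  have he : children par (some v) \ F = ∅ := by
    refine Finset.eq_empty_of_forall_notMem fun c hc => ?_
    simp only [Finset.mem_sdiff, mem_children] at hc
    have h1 := hr.depth_eq c v hc.1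
    have h2 := hmax c (by simpa using hc.2)
    omega
  exact hdeg v (by simp [h.deg v (by simpa using hv), he])

/-- Deal with all vertices. -/
def climbAll : Prog := .while (.le 5 4) climb

theorem climbAll_spec (hr : IsRooting G r par depth) {σ : State}
    (h : Progress G par k F D rem σ) (h4 : σ.reg 4 = 8 * n) (h5 : σ.reg 5 = 8) {b R : ℕ}
    (hb : ∑ v ∈ Fᶜ, weight par v + 7 * n + 1 + R ≤ b) :
    Runs climbAll σ b fun τ b' => ∃ D' rem', Progress G par k Finset.univ D' rem' τ ∧
      Keeps [4] σ τ ∧ R ≤ b' := by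
  refine Runs.loop (fun τ b => ∃ F' D' rem', ∃ i ≤ n, Progress G par k F' D' rem' τ ∧
    Keeps [4] σ τ ∧ τ.reg 5 = 8 * ((i : ℤ) + 1) ∧
    (∀ j : Fin n, (j : ℕ) < i → τ.mem (addr .deg (some j)) ≠ 1) ∧
    ∑ v ∈ F'ᶜ, weight par v + 7 * (n - i) + 1 + R ≤ b) ?_ ?_ ?_
  · rintro τ b ⟨F', D', rem', i, hi, hP, hk, h5, hd, hb⟩ hle
    have k4 := (hk.1 4 (by simp)).trans h4
    simp only [Test.Holds, k4, h5] at hle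
    have hi' : i < n := by omega
    refine ⟨b - 1, by omega, (climb_spec hr hP (i := ⟨i, hi'⟩)
      (by rw [h5, base_some]; push_cast; rfl) (fun j hj => hd j hj)
      (R := 7 * (n - (i + 1)) + 1 + R) (by omega)).mono le_rfl ?_⟩
    rintro τ' b' ⟨F'', D'', rem'', hP', hk', h5', hd', hb'⟩
    refine ⟨F'', D'', rem'', i + 1, hi', hP', hk.trans hk', ?_, fun j hj => hd' j ?_, by omega⟩
    · rw [h5', h5]; push_cast; ring
    · exact Fin.le_def.2 (Nat.lt_succ_iff.1 hj)
  · rintro τ b ⟨F', D', rem', i, hi, hP, hk, h5, hd, hb⟩ hle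
    have k4 := (hk.1 4 (by simp)).trans h4
    simp only [Test.Holds, k4, h5] at hle
    have hF := hP.pruned.eq_univ hr fun j => hd j (by have := j.2; omega)
    subst hF
    exact ⟨b - 1, by omega, D', rem', hP, hk, by omega⟩
  · exact ⟨F, D, rem, 0, Nat.zero_le _, h, Keeps.refl _ _, by simp [h5], by simp, by simpa using hb⟩

end

/-! ### Reading the input -/

/-- Read a vertex, and turn it into the address of its record. -/
def readVertex (s : ℕ) : Prog :=
  .seq (.read s) (.seq (.add s s 2) (.seq (.add s s s) (.seq (.add s s s) (.add s s s))))

/-- Read an edge. -/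
def readEdge : Prog :=
  .seq (readVertex 6) (.seq (readVertex 7) (.seq (addField 6 .deg 2) (.seq (addField 7 .deg 2)
    (.seq (addField 6 .sum 7) (.seq (addField 7 .sum 6) (.sub 15 15 2))))))

/-- Read the input, and count the missing parent of the vertex `0` as a neighbour. -/
def readInput : Prog :=
  .seq (.seq (.read 4) (.seq (.read 15) (.seq (.read 3) (.const 2 1))))
    (.seq (.while (.lt 1 15) readEdge)
      (.seq (.seq (.const 6 8) (addField 6 .deg 2))
        (.seq (.const 14 8) (.seq (.const 5 8) (.seq (.add 4 4 4) (.seq (.add 4 4 4)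
          (.add 4 4 4)))))))

section

variable {n : ℕ} {σ : State}

theorem wp_readVertex {s : ℕ} (hs : 3 ≤ s) {u : Fin n} {rest : List ℤ} (h2 : σ.reg 2 = 1)
    (hi : σ.inp = ((u : ℕ) : ℤ) :: rest) :
    (readVertex s).wp (fun τ => (∀ r, r ≠ s → τ.reg r = σ.reg r) ∧ τ.reg s = base (some u) ∧
      τ.mem = σ.mem ∧ τ.inp = rest ∧ τ.out = σ.out) σ := by
  have hs2 : (2 : ℕ) ≠ s := by omega
  refine ⟨_, _, hi, ?_⟩
  simp only [Prog.wp, State.setReg, Function.update_self, Function.update_of_ne hs2, h2]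
  refine ⟨fun r hr => by simp [hr], ?_, trivial, trivial, trivial⟩
  rw [base_some]
  push_cast
  ring

theorem wp_readEdge {u v : Fin n} (huv : u ≠ v) {rest : List ℤ} (h2 : σ.reg 2 = 1)
    (hi : σ.inp = ((u : ℕ) : ℤ) :: ((v : ℕ) : ℤ) :: rest) :
    readEdge.wp (fun τ => (∀ r ∈ [1, 2, 3, 4, 13], τ.reg r = σ.reg r) ∧
      τ.reg 15 = σ.reg 15 - 1 ∧ τ.inp = rest ∧ τ.out = σ.out ∧
      τ.mem = Function.update (Function.update (Function.update (Function.update σ.mem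
        (addr .deg (some u)) (σ.mem (addr .deg (some u)) + 1))
        (addr .deg (some v)) (σ.mem (addr .deg (some v)) + 1))
        (addr .sum (some u)) (σ.mem (addr .sum (some u)) + base (some v)))
        (addr .sum (some v)) (σ.mem (addr .sum (some v)) + base (some u))) σ := by
  change (readVertex 6).wp (Prog.wp _ _) σ
  refine Prog.wp_mono (wp_readVertex (s := 6) (by omega) h2 hi) ?_
  rintro σ₁ ⟨hr₁, h6, hm₁, hi₁, ho₁⟩
  change (readVertex 7).wp (Prog.wp _ _) σ₁
  refine Prog.wp_mono (wp_readVertex (s := 7) (by omega) ((hr₁ 2 (by simp)).trans h2) hi₁) ?_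
  rintro σ₂ ⟨hr₂, h7, hm₂, hi₂, ho₂⟩
  have e2 : σ₂.reg 2 = 1 := by rw [hr₂ 2 (by simp), hr₁ 2 (by simp), h2]
  have e6 : σ₂.reg 6 = base (some u) := by rw [hr₂ 6 (by simp), h6]
  have e15 : σ₂.reg 15 = σ.reg 15 := by rw [hr₂ 15 (by simp), hr₁ 15 (by simp)]
  have e1 : σ₂.reg 1 = σ.reg 1 := by rw [hr₂ 1 (by simp), hr₁ 1 (by simp)]
  have e3 : σ₂.reg 3 = σ.reg 3 := by rw [hr₂ 3 (by simp), hr₁ 3 (by simp)]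
  have e4 : σ₂.reg 4 = σ.reg 4 := by rw [hr₂ 4 (by simp), hr₁ 4 (by simp)]
  have e13 : σ₂.reg 13 = σ.reg 13 := by rw [hr₂ 13 (by simp), hr₁ 13 (by simp)]
  simp [Prog.wp, State.setReg, State.setMem, addField, getField, putField, Function.update_apply,
    e1, e2, e3, e4, e6, e13, e15, h7, hi₂, ho₂, ho₁, hm₂, hm₁, h2, huv.symm]

/-- The sum of `f` over the neighbours of `v` according to a list of edges. -/
def listSum (f : Fin n → ℤ) (L : List (Fin n × Fin n)) (v : Fin n) : ℤ :=
  (L.map fun e => (if e.1 = v then f e.2 else 0) + if e.2 = v then f e.1 else 0).sum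

/-- The encoding of a list of edges. -/
def encodeEdges (L : List (Fin n × Fin n)) : List ℤ :=
  L.flatMap fun p => [((p.1 : ℕ) : ℤ), ((p.2 : ℕ) : ℤ)]

/-- The situation while the edges are read. -/
structure ReadInv (n : ℕ) (k : ℤ) (deg sum : Fin n → ℤ) (rest : List (Fin n × Fin n))
    (σ : State) : Prop where
  zero : σ.reg 1 = 0
  one : σ.reg 2 = 1
  demand : σ.reg 3 = k
  size : σ.reg 4 = n
  flag : σ.reg 13 = 0
  count : σ.reg 15 = rest.length
  inp : σ.inp = encodeEdges rest
  out : σ.out = []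
  deg_eq : ∀ v, σ.mem (addr .deg (some v)) + listSum (fun _ => 1) rest v = deg v
  sum_eq : ∀ v, σ.mem (addr .sum (some v)) + listSum (fun u => base (some u)) rest v = sum v
  deg_none : σ.mem (addr .deg (none : Option (Fin n))) = 0
  ind : ∀ o : Option (Fin n), σ.mem (addr .ind o) = 0
  cnt : ∀ o : Option (Fin n), σ.mem (addr .cnt o) = 0
  head : ∀ o : Option (Fin n), σ.mem (addr .head o) = 0

/-- The contribution of the edge moves from `listSum` to memory, so the totals stay the same.
Distinct ends keep the updates of the two records apart. -/
theorem ReadInv.step {k : ℤ} {deg sum : Fin n → ℤ} {e : Fin n × Fin n}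
    {rest : List (Fin n × Fin n)} (h : ReadInv n k deg sum (e :: rest) σ) (he : e.1 ≠ e.2) :
    readEdge.wp (ReadInv n k deg sum rest) σ := by
  refine Prog.wp_mono (wp_readEdge he h.one h.inp) ?_
  rintro τ ⟨hr, h15, hi, ho, hm⟩
  refine ⟨(hr 1 (by simp)).trans h.zero, (hr 2 (by simp)).trans h.one,
    (hr 3 (by simp)).trans h.demand, (hr 4 (by simp)).trans h.size,
    (hr 13 (by simp)).trans h.flag, ?_, hi, ho.trans h.out, ?_, ?_, ?_, ?_, ?_, ?_⟩
  · rw [h15, h.count]; simp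
  · intro v
    rw [← h.deg_eq v, hm]
    simp only [Function.update_apply, addr_inj, reduceCtorEq, false_and, if_false, true_and,
      Option.some.injEq, listSum, List.map_cons, List.sum_cons]
    by_cases h1 : v = e.1
    · subst h1
      simp [he, he.symm]; ring
    · by_cases h2 : v = e.2
      · subst h2
        simp [he]; ring
      · simp [h1, h2, Ne.symm h1, Ne.symm h2]
  · intro v
    rw [← h.sum_eq v, hm]
    simp only [Function.update_apply, addr_inj, reduceCtorEq, false_and, if_false, true_and,
      Option.some.injEq, listSum, List.map_cons, List.sum_cons]
    by_cases h1 : v = e.1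
    · subst h1
      simp [he, he.symm]; ring
    · by_cases h2 : v = e.2
      · subst h2
        simp [he]; ring
      · simp [h1, h2, Ne.symm h1, Ne.symm h2]
  · simp [hm, h.deg_none]
  · intro o; simp [hm, h.ind]
  · intro o; simp [hm, h.cnt]
  · intro o; simp [hm, h.head]

/-- Each edge `e` occurs once and contributes `f u` exactly if `e = s(v, u)`. Exchanging the two
summations gives a sum over the neighbours of `v`, which are its children and its parent. -/
theorem listSum_eq {G : SimpleGraph (Fin n)} {r : Fin n} {par : Fin n → Option (Fin n)}
    {depth : Fin n → ℕ} (hr : IsRooting G r par depth) {L : List (Fin n × Fin n)}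
    (hL : IsEdgeList G L) (f : Fin n → ℤ) (v : Fin n) :
    listSum f L v = ∑ c ∈ children par (some v), f c + (par v).elim 0 f := by
  classical
  have h1 : ∀ e ∈ L, ((if e.1 = v then f e.2 else 0) + if e.2 = v then f e.1 else 0) =
      ∑ u, if s(e.1, e.2) = s(v, u) then f u else 0 := by
    rintro ⟨a, b⟩ he
    dsimp only
    have hadj : G.Adj a b := by
      have := (hL.2 s(a, b)).1 (List.mem_map.2 ⟨(a, b), he, rfl⟩)
      simpa using this
    have hne := hadj.ne
    by_cases h1 : a = v
    · have h2 : b ≠ v := fun h => hne (h1.trans h.symm)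
      simp [h1, h2]
    · by_cases h2 : b = v <;> simp [h1, h2]
  have h2 : listSum f L v = ∑ e ∈ (L.map fun p => s(p.1, p.2)).toFinset,
      ∑ u, if e = s(v, u) then f u else 0 := by
    rw [List.sum_toFinset _ hL.1, List.map_map, listSum]
    exact congrArg List.sum (List.map_congr_left h1)
  have h3 : ∀ u, s(v, u) ∈ (L.map fun p => s(p.1, p.2)).toFinset ↔
      par u = some v ∨ par v = some u := by
    intro u
    rw [List.mem_toFinset, hL.2, SimpleGraph.mem_edgeSet, hr.adj_iff, or_comm]
  rw [h2, Finset.sum_comm]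
  simp only [Finset.sum_ite_eq', h3]
  have h4 : ∀ u, (if par u = some v ∨ par v = some u then f u else 0) =
      (if par u = some v then f u else 0) + if par v = some u then f u else 0 := by
    intro u
    by_cases h5 : par u = some v
    · have h6 : par v ≠ some u := fun h6 => by
        have := hr.depth_eq _ _ h5
        have := hr.depth_eq _ _ h6
        omega
      simp [h5, h6]
    · simp [h5]
  simp only [h4, Finset.sum_add_distrib]
  congr 1
  · rw [children, Finset.sum_filter]
  · cases hv : par v with
    | none => simp
    | some q => simp

theorem readInput_spec [NeZero n] {G : SimpleGraph (Fin n)} {par : Fin n → Option (Fin n)}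
    {depth : Fin n → ℕ} (hr : IsRooting G 0 par depth) {L : List (Fin n × Fin n)}
    (hL : IsEdgeList G L) (k : ℤ) {b R : ℕ} (hb : 40 * L.length + 20 + R ≤ b) :
    Runs readInput (State.init (encodeInstance n L k)) b fun τ b' =>
      Progress G par k ∅ ∅ (fun _ => []) τ ∧ τ.reg 4 = 8 * n ∧ τ.reg 5 = 8 ∧ τ.out = [] ∧
        R ≤ b' := by
  have hne : ∀ e ∈ L, e.1 ≠ e.2 := by
    intro e he
    have : G.Adj e.1 e.2 := by
      have := (hL.2 s(e.1, e.2)).1 (List.mem_map.2 ⟨e, he, rfl⟩)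
      simpa using this
    exact this.ne
  refine Runs.seq (Runs.of_wp (b' := b - 4) ?_ (by simp [Prog.cost]; omega))
  refine ⟨_, _, rfl, _, _, rfl, _, _, rfl, ?_⟩
  refine Runs.seq (Runs.loop (fun τ b => ∃ rest, (∀ e ∈ rest, e.1 ≠ e.2) ∧
    ReadInv n k (listSum (fun _ => 1) L) (listSum (fun u => base (some u)) L) rest τ ∧
    40 * rest.length + 16 + R ≤ b) ?_ ?_ ?_)
  · rintro τ b ⟨rest, hrest, hinv, hb⟩ hpos
    cases rest with
    | nil => simp [Test.Holds, hinv.zero, hinv.count] at hpos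
    | cons e rest =>
      rw [List.length_cons] at hb
      refine ⟨b - 1, by omega, Runs.of_wp (b' := b - 40) (Prog.wp_mono
        (hinv.step (hrest e (by simp))) fun τ' hτ' => ⟨rest, fun e' he' => hrest e' (by simp [he']),
          hτ', by omega⟩) ?_⟩
      simp [readEdge, readVertex, addField, getField, putField, Prog.cost]
      omega
  · rintro τ b ⟨rest, hrest, hinv, hb⟩ hneg
    cases rest with
    | cons e rest =>
      simp [Test.Holds, hinv.zero, hinv.count] at hneg
    | nil =>
      -- The root `0` has its record at address `8`. It gets one extra unit of degree for its
      -- missing parent, whose address `0` does not affect the sum.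
      have h6 : (8 : ℤ) = base (some (0 : Fin n)) := by simp [base_some]
      have hdeg : ∀ v, τ.mem (addr .deg (some v)) = (children par (some v)).card +
          (par v).elim 0 fun _ => 1 := by
        intro v
        have := hinv.deg_eq v
        rw [listSum_eq hr hL] at this
        simpa [listSum] using this
      have hsum : ∀ v, τ.mem (addr .sum (some v)) =
          ∑ c ∈ children par (some v), (base (some c) : ℤ) + base (par v) := by
        intro v
        have := hinv.sum_eq v
        rw [listSum_eq hr hL] at this
        cases hv : par v <;> simpa [listSum, hv] using this
      refine ⟨b - 1, by omega, Runs.seq (Runs.of_wp (b' := b - 9) ?_ (by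
        simp [addField, getField, putField, Prog.cost]; omega))⟩
      simp only [Prog.wp, State.setReg, h6, addField, getField, putField, State.setMem,
        Function.update_self, Function.update_of_ne (show (6 : ℕ) ≠ 0 by simp),
        Function.update_of_ne (show (6 : ℕ) ≠ 10 by simp),
        Function.update_of_ne (show (10 : ℕ) ≠ 0 by simp), base_add_offset_nonneg,
        toNat_base_add_offset, true_and]
      refine Runs.of_wp (b' := b - 15) ?_ (by simp [Prog.cost]; omega)
      simp only [Prog.wp, State.setReg, Function.update_apply]
      refine ⟨⟨by simp [hinv.zero], by simp [hinv.one], by simp [hinv.demand], by simp [base_some],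
        ⟨by simp, ?_, by simp, ?_, ?_⟩, ⟨?_, ?_, ?_, by simp, by simp, by simp⟩, ?_⟩, ?_, by simp,
        hinv.out, by omega⟩
      · intro v _
        by_cases hv : v = 0
        · subst hv
          simp [hdeg, (hr.par_eq_none 0).2 rfl, hinv.one]
        · obtain ⟨q, hq⟩ : ∃ q, par v = some q :=
            Option.ne_none_iff_exists'.1 fun h => hv ((hr.par_eq_none v).1 h)
          simp [hdeg, hv, hq]
      · simp [hinv.deg_none]
      · intro v _
        simp [hsum]
      · intro o
        cases o <;> simp [hinv.ind]
      · intro v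
        simp [hinv.cnt]
      · intro v
        simp [hinv.head, IsChain]
      · exact Or.inl ⟨by simp [hinv.flag], ⟨by simp, by simp⟩, extendable_empty G k⟩
      · simp [hinv.size, base_some]; ring
  · refine ⟨L, hne, ⟨?_, ?_, ?_, ?_, ?_, ?_, rfl, rfl, ?_, ?_, rfl, fun _ => rfl, fun _ => rfl,
      fun _ => rfl⟩, by omega⟩ <;> simp [State.setReg, State.init]

end

/-! ### Writing the output -/

/-- Write the vertex in register `6` if it has been chosen, and move on to the next one. -/
def emit : Prog :=
  .seq (getField 10 5 .ind) (.seq (.ite (.eq 10 2) (.write 6) .skip)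
    (.seq (.add 5 5 14) (.add 6 6 2)))

/-- Write the chosen vertices. -/
def emitAll : Prog :=
  .seq (.seq (.write 2) (.seq (.const 5 8) (.const 6 0))) (.while (.le 5 4) emit)

/-- The program for the minimum `k`-vertex-edge domination problem. -/
def kveProgram : Prog :=
  .seq readInput (.seq climbAll (.ite (.eq 13 2) (.write 1) emitAll))

/-! ### Correctness of the output and of the whole program. -/

section

variable {n : ℕ}

/-- The chosen vertices among the first `i` ones. -/
def chosen (D : Finset (Fin n)) (i : ℕ) : List (Fin n) :=
  ((List.finRange n).take i).filter (· ∈ D)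

theorem chosen_succ (D : Finset (Fin n)) {i : ℕ} (hi : i < n) :
    chosen D (i + 1) = chosen D i ++ if (⟨i, hi⟩ : Fin n) ∈ D then [⟨i, hi⟩] else [] := by
  rw [chosen, List.take_succ_eq_append_getElem (by simpa using hi), List.filter_append]
  simp [chosen, List.filter_singleton]

theorem nodup_chosen (D : Finset (Fin n)) : (chosen D n).Nodup :=
  ((List.nodup_finRange n).sublist (List.take_sublist _ _)).filter _

theorem toFinset_chosen (D : Finset (Fin n)) : (chosen D n).toFinset = D := by
  ext v
  rw [chosen, List.take_of_length_le (by simp)]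
  simp

theorem emitAll_spec {D : Finset (Fin n)} {σ : State} (h2 : σ.reg 2 = 1)
    (h14 : σ.reg 14 = 8) (h4 : σ.reg 4 = 8 * n) (ho : σ.out = [])
    (hind : ∀ o, σ.mem (addr .ind o) = indicator D o) {b R : ℕ} (hb : 8 * n + 4 + R ≤ b) :
    Runs emitAll σ b fun τ b' =>
      τ.out = 1 :: (chosen D n).map (fun v => ((v : ℕ) : ℤ)) ∧ R ≤ b' := by
  refine Runs.seq (Runs.of_wp (b' := b - 3) ?_ (by simp [Prog.cost]; omega))
  simp only [Prog.wp, State.setReg]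
  refine Runs.loop (fun τ b => ∃ i ≤ n, τ.reg 2 = 1 ∧ τ.reg 14 = 8 ∧ τ.reg 4 = 8 * n ∧
    τ.reg 5 = 8 * ((i : ℤ) + 1) ∧ τ.reg 6 = i ∧ (∀ o, τ.mem (addr .ind o) = indicator D o) ∧
    τ.out = 1 :: (chosen D i).map (fun v => ((v : ℕ) : ℤ)) ∧ 8 * (n - i) + 1 + R ≤ b) ?_ ?_ ?_
  · rintro τ b ⟨i, hi, k2, k14, k4, k5, k6, km, ko, hb⟩ hle
    simp only [Test.Holds, k4, k5] at hle
    have hi' : i < n := by omega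
    have k5' : τ.reg 5 = base (some (⟨i, hi'⟩ : Fin n)) := by
      rw [k5, base_some]; push_cast; rfl
    refine ⟨b - 1, by omega, Runs.of_wp (b' := b - 8) ?_ (by
      simp [emit, getField, Prog.cost]; omega)⟩
    by_cases hD : (⟨i, hi'⟩ : Fin n) ∈ D
    · simp [emit, getField, Prog.wp, State.setReg, Test.Holds, k2, k14, k4,
        k5', k6, km, ko, hD]
      refine ⟨i + 1, by omega, ?_, by simp, by simp [chosen_succ D hi', hD], by omega⟩
      rw [base_some]; push_cast; ring
    · simp [emit, getField, Prog.wp, State.setReg, Test.Holds, k2, k14, k4,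
        k5', k6, km, ko, hD]
      refine ⟨i + 1, by omega, ?_, by simp, by simp [chosen_succ D hi', hD], by omega⟩
      rw [base_some]; push_cast; ring
  · rintro τ b ⟨i, hi, k2, k14, k4, k5, k6, km, ko, hb⟩ hle
    simp only [Test.Holds, k4, k5] at hle
    obtain rfl : i = n := by omega
    exact ⟨b - 1, by omega, ko, by omega⟩
  · exact ⟨0, Nat.zero_le _, by simp [h2], by simp [h14], by simp [h4], by simp, by simp, hind,
      by simp [ho, h2, chosen], by omega⟩

theorem IsEdgeList.length_add_one {T : SimpleGraph (Fin n)} (hT : T.IsTree)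
    {L : List (Fin n × Fin n)} (hL : IsEdgeList T L) : L.length + 1 = n := by
  classical
  have h : (L.map fun p => s(p.1, p.2)).toFinset = T.edgeFinset := by
    ext e
    rw [List.mem_toFinset, hL.2, SimpleGraph.mem_edgeFinset]
  have h1 := hT.card_edgeFinset
  rw [← h, List.toFinset_card_of_nodup hL.1] at h1
  simpa using h1

/-- The constant is `324 = 40 + 269 + 7 + 8`, for reading, treating, scanning and writing. A tree
has only `n - 1` edges to read, and the `40` steps saved absorb the additive constants. -/
theorem kveProgram_spec {T : SimpleGraph (Fin n)} (hT : T.IsTree) (k : ℤ)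
    {L : List (Fin n × Fin n)} (hL : IsEdgeList T L) :
    Runs kveProgram (State.init (encodeInstance n L k)) (324 * n) fun τ _ =>
      IsCorrectAnswer T k τ.out := by
  have hlen := hL.length_add_one hT
  have : NeZero n := ⟨by omega⟩
  obtain ⟨par, depth, hr⟩ := exists_isRooting hT (0 : Fin n)
  have hw := sum_weight_le par
  refine Runs.seq ((readInput_spec hr hL k (R := 284 * n + 6) (by omega)).mono le_rfl ?_)
  rintro σ b ⟨hP, h4, h5, ho, hb⟩
  refine Runs.seq ((climbAll_spec hr hP h4 h5 (R := 8 * n + 5) (by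
    rw [Finset.compl_empty]; omega)).mono le_rfl ?_)
  rintro τ b' ⟨D, rem, hP', hk, hb'⟩
  refine (Runs.ite (b := 8 * n + 4) ?_ ?_).mono hb' fun _ _ h => h
  · intro hflag
    have hflag : τ.reg 13 = 1 := by simpa [Test.Holds, hP'.one] using hflag
    refine Runs.of_wp (b' := 0) ?_ (by simp [Prog.cost])
    rcases hP'.verdict with ⟨hf, -⟩ | ⟨-, hno⟩
    · omega
    · exact Or.inr ⟨hno, by simp [hk.2.2, ho, hP'.zero]⟩
  · intro hflag
    have hflag : τ.reg 13 ≠ 1 := by simpa [Test.Holds, hP'.one] using hflag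
    refine (emitAll_spec hP'.one hP'.eight ((hk.1 4 (by simp)).trans h4) (hk.2.2.trans ho)
      hP'.recorded.ind (R := 0) le_rfl).mono le_rfl ?_
    rintro ρ b'' ⟨hout, -⟩
    rcases hP'.verdict with ⟨-, hS, hE⟩ | ⟨hf, -⟩
    · refine Or.inl ⟨chosen D n, nodup_chosen D, ?_, hout⟩
      rw [toFinset_chosen]
      exact hr.isMin hS hE
    · exact absurd hf hflag

end

end VEDom

/-- The minimum `k`-vertex-edge domination problem can be solved in linear time for trees. -/
theorem theorem2 :
    ∃ (P : RAM.Prog) (c : ℕ),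
      ∀ (n : ℕ) (T : SimpleGraph (Fin n)), T.IsTree →
        ∀ (k : ℤ) (L : List (Fin n × Fin n)), VEDom.IsEdgeList T L →
          ∃ (t : ℕ) (out : List ℤ),
            t ≤ c * n ∧
            RAM.Computes P (VEDom.encodeInstance n L k) t out ∧
            VEDom.IsCorrectAnswer T k out := by
  refine ⟨VEDom.kveProgram, 324, fun n T hT k L hL => ?_⟩
  obtain ⟨t, τ, b', he, hb, hτ⟩ := VEDom.kveProgram_spec hT k hL
  exact ⟨t, τ.out, by omega, ⟨τ, he, rfl⟩, hτ⟩
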